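/- **Conventions.** Logarithms are to base $2$; $H(x)=\sum_i x_i\log\frac1{x_i}$ is the Shannon entropy of a finite array of non-negative reals, with $0\log\frac10=0$. Vectors of unequal length are compared by padding the shorter one with zeros. For probability vectors $\mathbf x,\mathbf y$ with non-increasing components, $\mathbf x\preceq\mathbf y$ (majorization) means $\sum_{l\le i}x_l\le\sum_{l\le i}y_l$ for all $i$. With this order the non-increasing probability vectors of length $n$ form a lattice; for probability vectors $\mathbf p^{(1)},\dots,\mathbf p^{(k)}\in\mathbb R^n$, $\mathbf p^{(1)}\wedge\dots\wedge\mathbf p^{(k)}$ denotes the greatest lower bound of their non-increasing rearrangements; its prefix sums are the minima of the prefix sums of these rearrangements. **Algorithm Min-Entropy-Joint-Distribution$(\mathbf p,\mathbf q)$** for non-increasing probability vectors of length $N$ (padded if necessary). If $\mathbf p\ne\mathbf q$ and $p_i<q_i$ at the last $i$ with $p_i\neq q_i$, run it on $(\mathbf q,\mathbf p)$ and transpose the result. Otherwise let $\mathbf z=\mathbf p\wedge\mathbf q$, let $i_0=N+1$, and for $s\ge1$, while $i_{s-1}>1$, let $i_s$ be the minimum index smaller than $i_{s-1}$ such that $\sum_{l=i}^Np_l\ge\sum_{l=i}^Nq_l$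 (for $s$ odd), respectively $\sum_{l=i}^Np_l\le\sum_{l=i}^Nq_l$ (for $s$ even), for all $i_s\le i<i_{s-1}$. Start with an $N\times N$ matrix $m=0$ and arrays $R=C=0$. For $s=1,2,\dots$ up to the index with $i_s=1$: * if $s$ is odd, for $j=i_{s-1}-1$ down to $i_s$: scan $l=j+1,j+2,\dots,i_{s-1}-1$ in this order, putting $l$ into $Q$ as long as the sum of the $R[l']$ with $l'\in Q$, plus $R[l]$, is $<q_j$, and stopping at the first failure; let $z^{(d)}=q_j-\sum_{l\in Q}R[l]$; for $l\in Q$ set $m_{l\,j}\leftarrow R[l]$ and then $R[l]\leftarrow0$; set $m_{j\,j}\leftarrow z^{(d)}$ and $R[j]\leftarrow z_j-z^{(d)}$. Afterwards, if $i_s\ne1$, for every $l\in[i_s,i_{s-1}-1]$ with $R[l]\neq0$ set $m_{l\,i_s-1}\leftarrow R[l]$, $R[l]\leftarrow0$; * if $s$ is even, do the same with the roles of rows and columns, of $R$ and $C$, and of $\mathbf p$ and $\mathbf q$ exchanged. The output is the matrix $m$ (rows belong to $\mathbf p$, columns to $\mathbf q$). **Algorithm K-Min-Entropy-Joint-Distribution**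 for $K=2^\kappa$ probability vectors of length $n$. Store for each input vector the list of its components, each with its index, sorted in non-increasing order of the values. For $\kappa$ rounds, replace the 1st and 2nd, the 3rd and 4th, … list by one list each: run Min-Entropy-Joint-Distribution on the two vectors of values; the new list consists of the non-zero entries $m_{s\,t}$ of the result, each with the concatenation of the index vectors of the $s$-th entry of the first and the $t$-th entry of the second list, again sorted in non-increasing order of the values. The output is the array $M\in\mathbb R^{n\times\dots\times n}$ ($K$ dimensions) that has the values of the final list at their index vectors, and $0$ elsewhere. If the number $k\ge1$ of distributions is not a power of $2$, the algorithm is run after repeating some of them until there are $K=2^{\lceil\log k\rceil}$ of them; each original distribution is thus represented by at least one coordinate of $M$. **Statement.** Let $k\ge1$, let $\mathbf p^{(1)},\dots,\mathbf p^{(k)}$ be any probability vectors of length $n$, and let $M$ be the output of K-Min-Entropy-Joint-Distribution on them (for $k$ not a power of $2$: on any list of $2^{\lceil\log k\rceil}$ vectors consisting of $\mathbf p^{(1)},\dots,\mathbf p^{(k)}$ and repetitions of them, in any order). Then $M$ is a joint distribution of its input distributions, and $$H(M)\le H\bigl(\mathbf p^{(1)}\wedge\mathbf p^{(2)}\wedge\dots\wedge\mathbf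 p^{(k)}\bigr)+\lceil\log k\rceil .$$ Consequently, if for each $i\le k$ one coordinate of $M$ that carries $\mathbf p^{(i)}$ as a repetition of the $i$-th distribution is chosen, then the marginal of $M$ on these $k$ coordinates is a joint distribution of $\mathbf p^{(1)},\dots,\mathbf p^{(k)}$, and its entropy satisfies the same bound. -/

import Mathlib

namespace MinEntropyJoint

/-- Shannon entropy in bits, with the convention `0 * log (1/0) = 0`. -/
noncomputable def entropy {ι : Type*} [Fintype ι] (x : ι → ℝ) : ℝ :=
  ∑ i, x i * Real.logb 2 (1 / x i)

/-! ### Ordered probability vectors and majorization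

A vector `(x₁, …, x_N)` is stored as a sequence `x : ℕ → ℝ` padded with zeros; positions are
counted from `0`. -/

/-- `x` is an ordered probability vector with (at most) `N` components, padded with zeros. -/
def IsOrderedProb (N : ℕ) (x : ℕ → ℝ) : Prop :=
  Antitone x ∧ (∀ i, 0 ≤ x i) ∧ (∀ i, N ≤ i → x i = 0) ∧ ∑ i ∈ Finset.range N, x i = 1

/-- `x` is majorized by `y` (both in non-increasing order). -/
def Majorized (x y : ℕ → ℝ) : Prop :=
  ∀ i, ∑ l ∈ Finset.range i, x l ≤ ∑ l ∈ Finset.range i, y l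

/-- The components of `p` in non-increasing order, padded with zeros. -/
noncomputable def sortDesc {n : ℕ} (p : Fin n → ℝ) : ℕ → ℝ :=
  fun i => ((List.ofFn p).insertionSort (fun a b => b ≤ a)).getD i 0

/-- The minimum over the family of the sums of the first `i` components. -/
def prefixMin {ι : Type*} [Fintype ι] [Nonempty ι] (x : ι → ℕ → ℝ) (i : ℕ) : ℝ :=
  Finset.univ.inf' Finset.univ_nonempty (fun a => ∑ l ∈ Finset.range i, x a l)

/-- The greatest lower bound, for majorization, of a finite family of ordered probability
vectors: the vector whose prefix sums are the minima of the prefix sums of the family. -/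
noncomputable def meet {ι : Type*} [Fintype ι] [Nonempty ι] (x : ι → ℕ → ℝ) : ℕ → ℝ :=
  fun i => prefixMin x (i + 1) - prefixMin x i

theorem sum_meet {ι : Type*} [Fintype ι] [Nonempty ι] (x : ι → ℕ → ℝ) (i : ℕ) :
    ∑ l ∈ Finset.range i, meet x l = prefixMin x i := by
  unfold meet
  rw [Finset.sum_range_sub]
  simp [prefixMin]

/-- `meet` is the greatest lower bound in the set of ordered probability vectors. -/
theorem meet_isGreatest {ι : Type*} [Fintype ι] [Nonempty ι] {N : ℕ} (x : ι → ℕ → ℝ)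
    (hx : ∀ a, IsOrderedProb N (x a)) :
    IsOrderedProb N (meet x) ∧ (∀ a, Majorized (meet x) (x a)) ∧
      ∀ w, IsOrderedProb N w → (∀ a, Majorized w (x a)) → Majorized w (meet x) := by
  have hle : ∀ a i, prefixMin x i ≤ ∑ l ∈ Finset.range i, x a l := fun a i =>
    Finset.inf'_le (f := fun a => ∑ l ∈ Finset.range i, x a l) (Finset.mem_univ a)
  have hex : ∀ i, ∃ a, prefixMin x i = ∑ l ∈ Finset.range i, x a l := fun i => by
    obtain ⟨a, -, ha⟩ := Finset.exists_mem_eq_inf' (Finset.univ_nonempty (α := ι))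
      (fun a => ∑ l ∈ Finset.range i, x a l)
    exact ⟨a, ha⟩
  have hone : ∀ a i, N ≤ i → ∑ l ∈ Finset.range i, x a l = 1 := fun a i hi => by
    rw [← (hx a).2.2.2]
    symm
    apply Finset.sum_subset (Finset.range_mono hi)
    intro l _ hl
    exact (hx a).2.2.1 l (by simpa using hl)
  have hbig : ∀ i, N ≤ i → prefixMin x i = 1 := fun i hi => by
    obtain ⟨a, ha⟩ := hex i
    rw [ha, hone a i hi]
  refine ⟨⟨antitone_nat_of_succ_le fun i => ?_, fun i => ?_, fun i hi => ?_, ?_⟩, ?_, ?_⟩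
  · obtain ⟨a, ha⟩ := hex (i + 1)
    have h1 := hle a i
    have h2 := hle a (i + 1 + 1)
    have h3 := (hx a).1 (Nat.le_succ i)
    rw [Finset.sum_range_succ] at ha h2
    rw [Finset.sum_range_succ] at h2
    simp only [meet]
    simp only [Nat.succ_eq_add_one] at h3
    linarith
  · obtain ⟨a, ha⟩ := hex (i + 1)
    have h1 := hle a i
    have h2 := (hx a).2.1 i
    rw [Finset.sum_range_succ] at ha
    simp only [meet]
    linarith
  · simp only [meet]
    rw [hbig i hi, hbig (i + 1) (by omega), sub_self]
  · rw [sum_meet, hbig N le_rfl]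
  · intro a i
    rw [sum_meet]
    exact hle a i
  · intro w _ hw i
    rw [sum_meet]
    obtain ⟨a, ha⟩ := hex i
    rw [ha]
    exact hw a i

/-! ### The algorithm for two distributions -/

/-- Suffix sum `∑_{i ≤ l < N} p_l`. -/
def suffixSum (N : ℕ) (p : ℕ → ℝ) (i : ℕ) : ℝ := ∑ l ∈ Finset.Ico i N, p l

/-- The minimum index `a ≤ b` such that `P i` holds for all `a ≤ i < b`. -/
def segStart (P : ℕ → Prop) [DecidablePred P] : ℕ → ℕ
  | 0 => 0
  | b + 1 => if P b then segStart P b else b + 1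

theorem segStart_isLeast (P : ℕ → Prop) [DecidablePred P] (b : ℕ) :
    IsLeast {a | a ≤ b ∧ ∀ i, a ≤ i → i < b → P i} (segStart P b) := by
  induction b with
  | zero => exact ⟨⟨le_rfl, fun i _ h => by omega⟩, fun a _ => Nat.zero_le a⟩
  | succ b ih =>
    unfold segStart
    split_ifs with h
    · refine ⟨⟨ih.1.1.trans (Nat.le_succ b), fun i hi hib => ?_⟩, fun a ha => ?_⟩
      · rcases Nat.lt_succ_iff_lt_or_eq.mp hib with h' | h'
        · exact ih.1.2 i hi h'
        · exact h' ▸ h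
      · rcases Nat.lt_or_ge b a with h' | h'
        · exact ih.1.1.trans h'.le
        · exact ih.2 ⟨h', fun i hi hib => ha.2 i hi (by omega)⟩
    · refine ⟨⟨le_rfl, fun i _ _ => by omega⟩, fun a ha => ?_⟩
      by_contra hc
      exact h (ha.2 b (by omega) (by omega))

/-- The inversion points of `p` and `q`: `i_0 = N` is one past the last position, and for odd
(even) `s` the segment `[i_s, i_{s-1})` is the maximal one, ending just before `i_{s-1}`, on which
the suffix sums of `p` are at least (at most) those of `q`. -/
noncomputable def inversionPoint (N : ℕ) (p q : ℕ → ℝ) : ℕ → ℕ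
  | 0 => N
  | s + 1 =>
    if Odd (s + 1) then
      segStart (fun i => suffixSum N q i ≤ suffixSum N p i) (inversionPoint N p q s)
    else
      segStart (fun i => suffixSum N p i ≤ suffixSum N q i) (inversionPoint N p q s)

/-- The number of segments: the least `s` for which `i_s` is the first position. -/
noncomputable def numSegments (N : ℕ) (p q : ℕ → ℝ) : ℕ :=
  sInf {s | inversionPoint N p q s = 0}

/-- The `while` loop selecting pieces: scan the indices in order and take the index `k` as long
as the running sum plus `A k` stays below `x`. Returns the running sum and the indices taken. -/
noncomputable def selectLoop (x : ℝ) (A : ℕ → ℝ) : List ℕ → ℝ → Finset ℕ → ℝ × Finset ℕ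
  | [], sum, Q => (sum, Q)
  | k :: ks, sum, Q =>
    if sum + A k < x then selectLoop x A ks (sum + A k) (insert k Q) else (sum, Q)

/-- Split `z` into `z_d + z_r` and choose a subset `Q` of the indices `a, a+1, …, b-1` such that
`z_d` together with the `A l`, `l ∈ Q`, adds up to `x`. Returns `(z_d, z_r, Q)`. -/
noncomputable def split (z x : ℝ) (A : ℕ → ℝ) (a b : ℕ) : ℝ × ℝ × Finset ℕ :=
  let r := selectLoop x A (List.range' a (b - a)) 0 ∅
  (x - r.1, z - (x - r.1), r.2)

/-- The variables of the algorithm: the matrix under construction and the two arrays of pieces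
still to be placed. -/
structure State where
  m : ℕ → ℕ → ℝ
  R : ℕ → ℝ
  C : ℕ → ℝ

/-- All variables are initially `0`. -/
def State.init : State := ⟨fun _ _ => 0, fun _ => 0, fun _ => 0⟩

/-- Body of the inner loop for column `j` in an odd segment; `b` is one past the end of the
segment. -/
noncomputable def colStep (z q : ℕ → ℝ) (b : ℕ) (st : State) (j : ℕ) : State :=
  let r := split (z j) (q j) st.R (j + 1) b
  { m := fun l c =>
      if c = j ∧ l = j then r.1 else if c = j ∧ l ∈ r.2.2 then st.R l else st.m l c
    R := fun l => if l = j then r.2.1 else if l ∈ r.2.2 then 0 else st.R l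
    C := st.C }

/-- After an odd segment `[a, b)`: move the remaining pieces to the column before it. -/
noncomputable def colFlush (a b : ℕ) (st : State) : State :=
  if a = 0 then st else
  { m := fun l c => if c = a - 1 ∧ a ≤ l ∧ l < b ∧ st.R l ≠ 0 then st.R l else st.m l c
    R := fun l => if a ≤ l ∧ l < b then 0 else st.R l
    C := st.C }

/-- Body of the inner loop for row `j` in an even segment. -/
noncomputable def rowStep (z p : ℕ → ℝ) (b : ℕ) (st : State) (j : ℕ) : State :=
  let r := split (z j) (p j) st.C (j + 1) b
  { m := fun l c =>
      if l = j ∧ c = j then r.1 else if l = j ∧ c ∈ r.2.2 then st.C c else st.m l c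
    R := st.R
    C := fun c => if c = j then r.2.1 else if c ∈ r.2.2 then 0 else st.C c }

/-- After an even segment `[a, b)`: move the remaining pieces to the row before it. -/
noncomputable def rowFlush (a b : ℕ) (st : State) : State :=
  if a = 0 then st else
  { m := fun l c => if l = a - 1 ∧ a ≤ c ∧ c < b ∧ st.C c ≠ 0 then st.C c else st.m l c
    R := st.R
    C := fun c => if a ≤ c ∧ c < b then 0 else st.C c }

/-- The iteration for segment `s ≥ 1`; positions are visited in decreasing order. -/
noncomputable def segmentStep (N : ℕ) (p q : ℕ → ℝ) (st : State) (s : ℕ) : State :=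
  let z := meet ![p, q]
  let a := inversionPoint N p q s
  let b := inversionPoint N p q (s - 1)
  let js := (List.range' a (b - a)).reverse
  if Odd s then colFlush a b (js.foldl (colStep z q b) st)
  else rowFlush a b (js.foldl (rowStep z p b) st)

/-- The main loop, for `p` and `q` in the right order. -/
noncomputable def mainLoop (N : ℕ) (p q : ℕ → ℝ) : ℕ → ℕ → ℝ :=
  ((List.range' 1 (numSegments N p q)).foldl (segmentStep N p q) State.init).m

/-- `p` and `q` have to be swapped: at the last position where they differ, `p` is smaller. -/
def NeedsSwap (N : ℕ) (p q : ℕ → ℝ) : Prop :=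
  ∃ i ∈ Finset.range N, p i < q i ∧ ∀ j ∈ Finset.range N, i < j → p j = q j

open Classical in
/-- **Min-Entropy-Joint-Distribution** for two ordered probability vectors with `N` components.
If `p` and `q` were swapped, the matrix is transposed back, so that rows belong to `p` and columns
to `q`. -/
noncomputable def minEntropyJoint (N : ℕ) (p q : ℕ → ℝ) : ℕ → ℕ → ℝ :=
  if NeedsSwap N p q then fun s t => mainLoop N q p t s else mainLoop N p q

/-! ### The algorithm for `2 ^ κ` distributions -/

/-- The list of the components of a joint distribution that are stored at a node of the tree, each
with the vector of its indices. -/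
abbrev Node (n : ℕ) := List (ℝ × List (Fin n))

/-- Sort the components of a node in non-increasing order of their values. -/
noncomputable def sortNode {n : ℕ} (a : Node n) : Node n :=
  a.insertionSort (fun u v => v.1 ≤ u.1)

/-- The node of a single distribution. -/
noncomputable def leaf {n : ℕ} (p : Fin n → ℝ) : Node n :=
  sortNode (List.ofFn fun j => (p j, [j]))

/-- The values stored at a node, padded with zeros. -/
def Node.val {n : ℕ} (a : Node n) (i : ℕ) : ℝ := (a.getD i (0, [])).1

/-- The index vectors stored at a node. -/
def Node.idx {n : ℕ} (a : Node n) (i : ℕ) : List (Fin n) := (a.getD i (0, [])).2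

/-- Join two nodes by the algorithm for two distributions (the shorter vector being padded with
zeros) and keep the non-zero components. -/
noncomputable def join {n : ℕ} (a b : Node n) : Node n :=
  let M := minEntropyJoint (max a.length b.length) (Node.val a) (Node.val b)
  sortNode ((List.range a.length).flatMap fun s =>
    ((List.range b.length).filter fun t => M s t ≠ 0).map fun t =>
      (M s t, Node.idx a s ++ Node.idx b t))

/-- The node at level `ℓ` for the block of distributions with (0-based) numbers
`s * 2 ^ ℓ, …, (s + 1) * 2 ^ ℓ - 1`. -/
noncomputable def node {n : ℕ} (p : ℕ → Fin n → ℝ) : ℕ → ℕ → Node n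
  | 0, s => leaf (p s)
  | l + 1, s => join (node p l (2 * s)) (node p l (2 * s + 1))

/-- **K-Min-Entropy-Joint-Distribution**: start from the zero array and write the components of
the root at their indices. -/
noncomputable def kMinEntropyJoint {n κ : ℕ} (p : Fin (2 ^ κ) → Fin n → ℝ) :
    (Fin (2 ^ κ) → Fin n) → ℝ :=
  (node (fun s => p (Fin.ofNat (2 ^ κ) s)) κ 0).foldl
    (fun M e x => if List.ofFn x = e.2 then e.1 else M x) (fun _ => 0)

/-! ### Joint distributions -/

/-- The array `M` is a joint distribution with marginals `p 0, …, p (k - 1)`. -/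
def IsJoint {n k : ℕ} (p : Fin k → Fin n → ℝ) (M : (Fin k → Fin n) → ℝ) : Prop :=
  (∀ x, 0 ≤ M x) ∧ ∀ i t, ∑ x with x i = t, M x = p i t

/-- The marginal of `M` on the coordinates `e 0, e 1, …`. -/
def marginal {n k K : ℕ} (e : Fin k → Fin K) (M : (Fin K → Fin n) → ℝ) :
    (Fin k → Fin n) → ℝ :=
  fun x => ∑ y with y ∘ e = x, M y

end MinEntropyJoint

open MinEntropyJoint

/-!
The two-vector algorithm splits every component `z i` of `z = p ∧ q` into at most two pieces: a
diagonal entry `(i, i)` and a piece that is placed later, in row `i` if `i` lies in an odd segment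
and in column `i` if it lies in an even one. In either case the second piece ends up in the *hook*
`{(l, c) | max l c = i}`, so the output is a joint distribution of `p` and `q` whose hook with
corner `(i, i)` has sum `z i` and at most two non-zero entries (`IsSplitCoupling`). The proof is an
invariant of the loops: on an odd segment the suffix sums of `z` are those of `p`, the pieces still
to be placed add up to the excess of the suffix sums of `z` over those of `q`, and the diagonal
entry is at most `z j` because `z` is non-increasing (`ColInv.colStep`). Even segments follow by
exchanging rows and columns.

Let `halve z` be `z` with each component replaced by two halves. Splitting each component into at
most two pieces gives a vector that majorizes `halve z`, and `halve` is monotone for majorization.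
Let `w` be the meet of all the input distributions. By induction on the level, the values stored at
a node of level `ℓ` majorize `halve^[ℓ] w`: if this holds for two nodes, it holds for the meet of
their values, and the join halves once more (`NodeInv.join`). Majorization is checked through
thresholds: the sum of the first `k` entries of a non-increasing sequence `x` is
`k c + ∑ i, max (x i - c) 0` for `c = x k`, an expression that does not depend on the order.

Entropy is Schur-concave (Gibbs' inequality and summation by parts), and halving adds one bit, so
the entropy at the root is at most `H(w) + κ`. Passing to a marginal does not increase the entropy,
because `t ↦ t * log (1 / t)` is subadditive.
-/

namespace MinEntropyJoint

/-! ### Selecting the pieces that fill up a column -/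

theorem selectLoop_spec (x : ℝ) (A : ℕ → ℝ) (ks : List ℕ) (sum : ℝ) (Q : Finset ℕ)
    (hks : ks.Nodup) (hdisj : ∀ l ∈ ks, l ∉ Q) (hsum : sum = ∑ l ∈ Q, A l) :
    (selectLoop x A ks sum Q).2 ⊆ Q ∪ ks.toFinset ∧
      (selectLoop x A ks sum Q).1 = ∑ l ∈ (selectLoop x A ks sum Q).2, A l ∧
      ((selectLoop x A ks sum Q).1 = sum ∨ (selectLoop x A ks sum Q).1 < x) ∧
      ((selectLoop x A ks sum Q).2 = Q ∪ ks.toFinset ∨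
        ∃ l ∈ ks, x ≤ (selectLoop x A ks sum Q).1 + A l) := by
  induction ks generalizing sum Q with
  | nil => simp [selectLoop, hsum]
  | cons k ks ih =>
    unfold selectLoop
    split_ifs with h
    · have hk : k ∉ Q := hdisj k (by simp)
      obtain ⟨h1, h2, h3, h4⟩ := ih (sum + A k) (insert k Q) hks.of_cons
        (fun l hl => by
          have : l ≠ k := fun e => (List.nodup_cons.mp hks).1 (e ▸ hl)
          simp [this, hdisj l (by simp [hl])])
        (by rw [Finset.sum_insert hk, hsum, add_comm])
      have hu : insert k Q ∪ ks.toFinset = Q ∪ (k :: ks).toFinset := by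
        ext l; simp only [Finset.mem_union, Finset.mem_insert, List.mem_toFinset, List.mem_cons]
        tauto
      rw [hu] at h1 h4
      refine ⟨h1, h2, Or.inr ?_, ?_⟩
      · rcases h3 with h3 | h3
        · rw [h3]; exact h
        · exact h3
      · rcases h4 with h4 | ⟨l, hl, h4⟩
        · exact Or.inl h4
        · exact Or.inr ⟨l, by simp [hl], h4⟩
    · exact ⟨Finset.subset_union_left, hsum, Or.inl rfl, Or.inr ⟨k, by simp, not_lt.mp h⟩⟩

/-- The piece `z_d` is non-negative, and it is at most one of the pieces on offer unless all of
them are used. -/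
theorem split_spec (z x : ℝ) (A : ℕ → ℝ) (a b : ℕ) (hx : 0 ≤ x) :
    (split z x A a b).1 = x - ∑ l ∈ (split z x A a b).2.2, A l ∧
      (split z x A a b).2.1 = z - (split z x A a b).1 ∧
      (split z x A a b).2.2 ⊆ Finset.Ico a b ∧ 0 ≤ (split z x A a b).1 ∧
      ((split z x A a b).2.2 = Finset.Ico a b ∨
        ∃ l ∈ Finset.Ico a b, (split z x A a b).1 ≤ A l) := by
  obtain ⟨h1, h2, h3, h4⟩ := selectLoop_spec x A (List.range' a (b - a)) 0 ∅
    (List.nodup_range' ..) (by simp) (by simp)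
  have hr : (∅ : Finset ℕ) ∪ (List.range' a (b - a)).toFinset = Finset.Ico a b := by
    ext l; simp only [Finset.empty_union, List.mem_toFinset, List.mem_range'_1, Finset.mem_Ico]
    omega
  rw [hr] at h1 h4
  refine ⟨?_, rfl, h1, ?_, ?_⟩
  · simp only [split]; rw [h2]
  · simp only [split]
    rcases h3 with h3 | h3 <;> linarith
  · rcases h4 with h4 | ⟨l, hl, h4⟩
    · exact Or.inl h4
    · refine Or.inr ⟨l, ?_, ?_⟩
      · simp only [List.mem_range'_1] at hl
        simp only [Finset.mem_Ico]; omega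
      · simp only [split]; linarith

/-! ### Hooks, and adding entries to one column of a matrix -/

/-- The hook with corner `(i, i)` in an `N × N` matrix: the positions `(l, c)` with
`max l c = i`. -/
def hook (N i : ℕ) : Finset (ℕ × ℕ) :=
  (Finset.range N ×ˢ Finset.range N).filter fun x => max x.1 x.2 = i

/-- The number of non-zero entries of `m` in the hook with corner `(i, i)`. -/
noncomputable def hookCard (N : ℕ) (m : ℕ → ℕ → ℝ) (i : ℕ) : ℕ :=
  ((hook N i).filter fun x => m x.1 x.2 ≠ 0).card

/-- The matrix `m` with `w` added to its column `j`. -/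
def addCol (m : ℕ → ℕ → ℝ) (j : ℕ) (w : ℕ → ℝ) : ℕ → ℕ → ℝ :=
  fun l c => m l c + if c = j then w l else 0

theorem mem_hook {N i : ℕ} {x : ℕ × ℕ} :
    x ∈ hook N i ↔ (x.1 < N ∧ x.2 < N) ∧ max x.1 x.2 = i := by
  simp [hook]

theorem sum_row_addCol {N j : ℕ} (hj : j < N) (m : ℕ → ℕ → ℝ) (w : ℕ → ℝ) (l : ℕ) :
    ∑ c ∈ Finset.range N, addCol m j w l c = ∑ c ∈ Finset.range N, m l c + w l := by
  simp [addCol, Finset.sum_add_distrib, hj]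

theorem sum_col_addCol (N j : ℕ) (m : ℕ → ℕ → ℝ) (w : ℕ → ℝ) (c : ℕ) :
    ∑ l ∈ Finset.range N, addCol m j w l c =
      ∑ l ∈ Finset.range N, m l c + if c = j then ∑ l ∈ Finset.range N, w l else 0 := by
  by_cases h : c = j <;> simp [addCol, Finset.sum_add_distrib, h]

theorem sum_hook_addCol {N i j : ℕ} (hji : j ≤ i) (hi : i < N) (m : ℕ → ℕ → ℝ) (w : ℕ → ℝ)
    (hw : ∀ l < j, w l = 0) :
    ∑ x ∈ hook N i, addCol m j w x.1 x.2 = ∑ x ∈ hook N i, m x.1 x.2 + w i := by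
  simp only [addCol, Finset.sum_add_distrib]
  congr 1
  rw [Finset.sum_eq_single (i, j)]
  · simp
  · rintro ⟨l, c⟩ hx hne
    rw [mem_hook] at hx
    simp only at hx ⊢
    split_ifs with hc
    · subst hc
      apply hw
      by_contra hl
      apply hne
      have : l = i := by rw [← hx.2]; omega
      rw [this]
    · rfl
  · intro h
    exact absurd (mem_hook.mpr ⟨⟨hi, by simp only; omega⟩, by simp [hji]⟩) h

theorem hookCard_addCol_le {N i j : ℕ} (m : ℕ → ℕ → ℝ) (w : ℕ → ℝ)
    (hw : ∀ l < j, w l = 0) :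
    hookCard N (addCol m j w) i ≤ hookCard N m i + if w i = 0 then 0 else 1 := by
  have hsub : (hook N i).filter (fun x => addCol m j w x.1 x.2 ≠ 0) ⊆
      (hook N i).filter (fun x => m x.1 x.2 ≠ 0) ∪ if w i = 0 then ∅ else {(i, j)} := by
    rintro ⟨l, c⟩ hx
    rw [Finset.mem_filter] at hx
    rw [Finset.mem_union]
    by_cases hm : m l c = 0
    · right
      have h2 := hx.2
      simp only [addCol, hm, zero_add, ne_eq, ite_eq_right_iff, Classical.not_imp] at h2
      obtain ⟨rfl, hwl⟩ := h2
      have hl : ¬ l < c := fun h => hwl (hw l h)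
      have hli : l = i := by
        have := (mem_hook.mp hx.1).2
        simp only at this
        omega
      subst hli
      simp [hwl]
    · left
      rw [Finset.mem_filter]
      exact ⟨hx.1, hm⟩
  refine (Finset.card_le_card hsub).trans ((Finset.card_union_le _ _).trans ?_)
  unfold hookCard
  gcongr
  split_ifs <;> simp

/-! ### The invariant within a segment -/

/-- The state of the algorithm within an odd segment that ends before position `b`, when the
positions from `j` on have been processed. Within the segment, row `l` and the hook with corner
`(l, l)` still lack the piece `R l`, and the only unprocessed row that can contain anything is the
one that received the pieces left over from the preceding segment. -/
structure ColInv (N : ℕ) (p q z : ℕ → ℝ) (b j : ℕ) (st : State) : Prop where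
  C_eq : ∀ l, st.C l = 0
  R_nonneg : ∀ l, 0 ≤ st.R l
  R_le : ∀ l, st.R l ≤ z l
  R_out : ∀ l, l < j ∨ b ≤ l → st.R l = 0
  m_nonneg : ∀ l c, 0 ≤ st.m l c
  m_lt : ∀ l c, l < b → c < j → st.m l c = 0
  m_out : ∀ l c, N ≤ l ∨ N ≤ c → st.m l c = 0
  hook_sum : ∀ i, j ≤ i → i < N → ∑ x ∈ hook N i, st.m x.1 x.2 + st.R i = z i
  hook_card : ∀ i, j ≤ i → i < N → hookCard N st.m i + (if st.R i = 0 then 0 else 1) ≤ 2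
  row_ge : ∀ i, j ≤ i → i < N → ∑ c ∈ Finset.range N, st.m i c + st.R i = p i
  row_lt : ∀ i, i < j → ∑ c ∈ Finset.range N, st.m i c =
    if i + 1 = b then suffixSum N z b - suffixSum N p b else 0
  col_ge : ∀ i, j ≤ i → i < N → ∑ l ∈ Finset.range N, st.m l i = q i
  col_lt : ∀ i, i < j → ∑ l ∈ Finset.range N, st.m l i = 0
  R_sum : ∑ l ∈ Finset.Ico j b, st.R l = suffixSum N z j - suffixSum N q j

theorem suffixSum_succ {N i : ℕ} (h : i < N) (p : ℕ → ℝ) :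
    suffixSum N p i = p i + suffixSum N p (i + 1) := by
  unfold suffixSum
  rw [Finset.sum_eq_sum_Ico_succ_bot h]

theorem suffixSum_self (N : ℕ) (p : ℕ → ℝ) : suffixSum N p N = 0 := by simp [suffixSum]

theorem ColInv.colStep {N : ℕ} {p q z : ℕ → ℝ} {b j : ℕ} {st : State}
    (hz : Antitone z) (hz0 : ∀ l, 0 ≤ z l) (hq : ∀ l, 0 ≤ q l)
    (hjb : j < b) (hbN : b ≤ N)
    (hP : suffixSum N z j = suffixSum N p j) (hQ : suffixSum N q j ≤ suffixSum N z j)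
    (hPs : j + 1 < b → suffixSum N z (j + 1) = suffixSum N p (j + 1))
    (h : ColInv N p q z b (j + 1) st) :
    ColInv N p q z b j (colStep z q b st j) := by
  obtain ⟨e1, e2, hQs, hd0, halt⟩ := split_spec (z j) (q j) st.R (j + 1) b (hq j)
  set d := (split (z j) (q j) st.R (j + 1) b).1 with hd
  set r := (split (z j) (q j) st.R (j + 1) b).2.1 with hr
  set Q := (split (z j) (q j) st.R (j + 1) b).2.2 with hQdef
  have hjN : j < N := by omega
  have hzs := suffixSum_succ hjN z
  have hqs := suffixSum_succ hjN q
  have hps := suffixSum_succ hjN p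
  -- the diagonal piece is at most `z j`, because it is at most a piece of some later component
  have hdz : d ≤ z j := by
    rcases halt with hall | ⟨l, hl, hle⟩
    · rw [hall, h.R_sum] at e1
      linarith
    · rw [Finset.mem_Ico] at hl
      exact hle.trans ((h.R_le l).trans (hz (by omega)))
  have hQmem : ∀ l ∈ Q, j < l ∧ l < b := fun l hl => by
    have := Finset.mem_Ico.mp (hQs hl); omega
  have hjQ : j ∉ Q := fun hl => by have := hQmem j hl; omega
  set w : ℕ → ℝ := fun l => if l = j then d else if l ∈ Q then st.R l else 0 with hw
  have hwlt : ∀ l < j, w l = 0 := fun l hl => by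
    have h1 : l ≠ j := by omega
    have h2 : l ∉ Q := fun hh => by have := hQmem l hh; omega
    simp [hw, h1, h2]
  have hwj : w j = d := by simp [hw]
  have hwne : ∀ l, l ≠ j → w l = if l ∈ Q then st.R l else 0 := fun l hl => by simp [hw, hl]
  have hw0 : ∀ l, 0 ≤ w l := fun l => by
    simp only [hw]
    split_ifs
    exacts [hd0, h.R_nonneg l, le_rfl]
  have hwb : ∀ l, b ≤ l → w l = 0 := fun l hl => by
    have h1 : l ≠ j := by omega
    have h2 : l ∉ Q := fun hh => by have := hQmem l hh; omega
    simp [hw, h1, h2]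
  have hm : (MinEntropyJoint.colStep z q b st j).m = addCol st.m j w := by
    funext l c
    simp only [MinEntropyJoint.colStep, addCol, ← hd, ← hQdef, hw]
    by_cases hc : c = j
    · subst hc
      by_cases hl : l = c
      · subst hl
        simp [h.m_lt l l hjb (Nat.lt_succ_self l)]
      · by_cases hlQ : l ∈ Q
        · simp [hl, hlQ, h.m_lt l c (hQmem l hlQ).2 (Nat.lt_succ_self c)]
        · simp [hl, hlQ]
    · simp [hc]
  have hRj : (MinEntropyJoint.colStep z q b st j).R j = r := by
    simp [MinEntropyJoint.colStep, hr]
  have hRne : ∀ l, l ≠ j → (MinEntropyJoint.colStep z q b st j).R l =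
      if l ∈ Q then 0 else st.R l := fun l hl => by
    simp [MinEntropyJoint.colStep, hl, hQdef]
  have hRw : ∀ l, l ≠ j → w l + (MinEntropyJoint.colStep z q b st j).R l = st.R l :=
    fun l hl => by
      rw [hwne l hl, hRne l hl]
      split_ifs <;> simp
  have hwsum : ∑ l ∈ Finset.range N, w l = q j := by
    have h1 : ∀ l, w l = (if l = j then d else 0) + if l ∈ Q then st.R l else 0 := fun l => by
      by_cases hl : l = j
      · subst hl; simp [hw, hjQ]
      · simp [hw, hl]
    have h2 : (Finset.range N).filter (· ∈ Q) = Q := by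
      ext l
      simp only [Finset.mem_filter, Finset.mem_range, and_iff_right_iff_imp]
      intro hl
      have := hQmem l hl
      omega
    simp_rw [h1, Finset.sum_add_distrib, Finset.sum_ite_eq', ← Finset.sum_filter, h2]
    rw [if_pos (by simpa using hjN), e1]
    ring
  have hR0 : ∀ l, 0 ≤ (MinEntropyJoint.colStep z q b st j).R l := fun l => by
    by_cases hl : l = j
    · rw [hl, hRj, e2]; linarith
    · rw [hRne l hl]; split_ifs
      exacts [le_rfl, h.R_nonneg l]
  have hRout : ∀ l, l < j ∨ b ≤ l → (MinEntropyJoint.colStep z q b st j).R l = 0 :=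
    fun l hl => by
      have hlj : l ≠ j := by omega
      rw [hRne l hlj, h.R_out l (by omega)]
      simp
  constructor
  · exact h.C_eq
  · exact hR0
  · intro l
    by_cases hl : l = j
    · rw [hl, hRj, e2]; linarith
    · rw [hRne l hl]; split_ifs
      exacts [hz0 l, h.R_le l]
  · exact hRout
  · intro l c
    rw [hm, addCol]
    have := h.m_nonneg l c
    have := hw0 l
    split_ifs <;> linarith
  · intro l c hl hc
    rw [hm, addCol, h.m_lt l c hl (by omega), if_neg (by omega), zero_add]
  · intro l c hlc
    rw [hm, addCol, h.m_out l c hlc, zero_add]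
    split_ifs with hc
    · exact hwb l (by omega)
    · rfl
  · intro i hi hiN
    rw [hm, sum_hook_addCol hi hiN _ _ hwlt]
    rcases hi.eq_or_lt with rfl | hi
    · rw [hwj, hRj, e2, Finset.sum_eq_zero]
      · ring
      · intro x hx
        have := (mem_hook.mp hx).2
        exact h.m_lt _ _ (by omega) (by omega)
    · rw [add_assoc, hRw i (by omega)]
      exact h.hook_sum i hi hiN
  · intro i hi hiN
    rw [hm]
    have hle := hookCard_addCol_le (N := N) (i := i) st.m w hwlt
    rcases hi.eq_or_lt with rfl | hi
    · have : hookCard N st.m j = 0 := by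
        rw [hookCard, Finset.card_eq_zero, Finset.filter_eq_empty_iff]
        intro x hx
        have := (mem_hook.mp hx).2
        rw [not_not]
        exact h.m_lt _ _ (by omega) (by omega)
      split_ifs at hle ⊢ <;> omega
    · have h2 := h.hook_card i hi hiN
      rw [hRne i (by omega)]
      rw [hwne i (by omega)] at hle
      by_cases hiQ : i ∈ Q
      · simp only [hiQ, if_true] at hle ⊢
        omega
      · simp only [hiQ, if_false, if_true] at hle ⊢
        omega
  · intro i hi hiN
    rw [hm, sum_row_addCol hjN]
    rcases hi.eq_or_lt with rfl | hi
    · rw [hwj, hRj, e2, h.row_lt j (Nat.lt_succ_self j)]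
      split_ifs with hb
      · rw [← hb]; linarith
      · have := hPs (by omega)
        linarith
    · rw [add_assoc, hRw i (by omega)]
      exact h.row_ge i hi hiN
  · intro i hi
    rw [hm, sum_row_addCol hjN, h.row_lt i (by omega), hwlt i hi, add_zero]
  · intro i hi hiN
    rw [hm, sum_col_addCol]
    rcases hi.eq_or_lt with rfl | hi
    · rw [h.col_lt j (Nat.lt_succ_self j), if_pos rfl, hwsum, zero_add]
    · rw [h.col_ge i hi hiN, if_neg (by omega), add_zero]
  · intro i hi
    rw [hm, sum_col_addCol, h.col_lt i (by omega), if_neg (by omega), add_zero]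
  · -- all pieces outside the segment vanish, so the sums may be taken over `range N`
    have hext : ∀ (A : ℕ → ℝ) (a : ℕ), (∀ l, l < a ∨ b ≤ l → A l = 0) →
        ∑ l ∈ Finset.Ico a b, A l = ∑ l ∈ Finset.range N, A l := fun A a hA => by
      apply Finset.sum_subset
      · intro l hl
        rw [Finset.mem_Ico] at hl
        rw [Finset.mem_range]; omega
      · intro l _ hl
        rw [Finset.mem_Ico] at hl
        exact hA l (by omega)
    have h1 := hext _ _ hRout
    have h2 := hext _ _ h.R_out
    have h3 : ∑ l ∈ Finset.range N, (w l + (MinEntropyJoint.colStep z q b st j).R l) =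
        ∑ l ∈ Finset.range N, (st.R l + if l = j then z j else 0) := by
      apply Finset.sum_congr rfl
      intro l _
      by_cases hl : l = j
      · rw [hl, hwj, hRj, e2, h.R_out j (Or.inl (Nat.lt_succ_self j))]
        simp
      · rw [hRw l hl, if_neg hl, add_zero]
    rw [Finset.sum_add_distrib, Finset.sum_add_distrib, hwsum, Finset.sum_ite_eq',
      if_pos (by simpa using hjN), ← h1, ← h2, h.R_sum] at h3
    linarith

theorem ColInv.foldl_colStep {N : ℕ} {p q z : ℕ → ℝ} {b : ℕ} {st : State}
    (hz : Antitone z) (hz0 : ∀ l, 0 ≤ z l) (hq : ∀ l, 0 ≤ q l) (hbN : b ≤ N)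
    (hQ : ∀ i, suffixSum N q i ≤ suffixSum N z i) (h : ColInv N p q z b b st) (d : ℕ) :
    ∀ a, a + d = b → (∀ i, a ≤ i → i < b → suffixSum N z i = suffixSum N p i) →
      ColInv N p q z b a
        (List.foldl (MinEntropyJoint.colStep z q b) st (List.range' a d).reverse) := by
  induction d with
  | zero =>
    intro a ha _
    obtain rfl : a = b := by omega
    simpa using h
  | succ d ih =>
    intro a ha hP
    rw [List.range'_succ, List.reverse_cons, List.foldl_append]
    exact (ih (a + 1) (by omega) fun i hi hib => hP i (by omega) hib).colStep hz hz0 hq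
      (by omega) hbN (hP a le_rfl (by omega)) (hQ a) fun h' => hP (a + 1) (by omega) h'

/-! ### The invariant between segments -/

/-- The state of the algorithm when the segments covering the positions from `b` on have been
processed. All pieces are placed, and of the unprocessed rows and columns only row and column
`b - 1` can have received something. -/
structure SegInv (N : ℕ) (p q z : ℕ → ℝ) (b : ℕ) (st : State) : Prop where
  R_eq : ∀ l, st.R l = 0
  C_eq : ∀ l, st.C l = 0
  m_nonneg : ∀ l c, 0 ≤ st.m l c
  m_lt : ∀ l c, l < b → c < b → st.m l c = 0
  m_out : ∀ l c, N ≤ l ∨ N ≤ c → st.m l c = 0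
  hook_sum : ∀ i, b ≤ i → i < N → ∑ x ∈ hook N i, st.m x.1 x.2 = z i
  hook_card : ∀ i, b ≤ i → i < N → hookCard N st.m i ≤ 2
  row_ge : ∀ i, b ≤ i → i < N → ∑ c ∈ Finset.range N, st.m i c = p i
  row_lt : ∀ i, i < b → ∑ c ∈ Finset.range N, st.m i c =
    if i + 1 = b then suffixSum N z b - suffixSum N p b else 0
  col_ge : ∀ i, b ≤ i → i < N → ∑ l ∈ Finset.range N, st.m l i = q i
  col_lt : ∀ i, i < b → ∑ l ∈ Finset.range N, st.m l i =
    if i + 1 = b then suffixSum N z b - suffixSum N q b else 0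

theorem SegInv.init (N : ℕ) (p q z : ℕ → ℝ) : SegInv N p q z N State.init := by
  constructor <;> intros <;> first | omega | simp [State.init, suffixSum_self]

theorem SegInv.colInv {N : ℕ} {p q z : ℕ → ℝ} {b : ℕ} {st : State} (hz0 : ∀ l, 0 ≤ z l)
    (hQ : suffixSum N z b = suffixSum N q b) (h : SegInv N p q z b st) :
    ColInv N p q z b b st where
  C_eq := h.C_eq
  R_nonneg l := (h.R_eq l).ge
  R_le l := (h.R_eq l).trans_le (hz0 l)
  R_out l _ := h.R_eq l
  m_nonneg := h.m_nonneg
  m_lt := h.m_lt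
  m_out := h.m_out
  hook_sum i hi hiN := by rw [h.R_eq, add_zero, h.hook_sum i hi hiN]
  hook_card i hi hiN := by simpa [h.R_eq] using h.hook_card i hi hiN
  row_ge i hi hiN := by rw [h.R_eq, add_zero, h.row_ge i hi hiN]
  row_lt := h.row_lt
  col_ge := h.col_ge
  col_lt i hi := by rw [h.col_lt i hi, hQ]; simp
  R_sum := by simp [hQ]

/-- After an odd segment the remaining pieces go to column `a - 1`, whose sum thereby becomes the
excess of the suffix sum of `z` over that of `q`; row `a - 1` has no such excess. -/
theorem ColInv.colFlush {N : ℕ} {p q z : ℕ → ℝ} {a b : ℕ} {st : State} (hab : a ≤ b)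
    (hbN : b ≤ N) (hP : suffixSum N z a = suffixSum N p a)
    (h0 : suffixSum N z 0 = suffixSum N q 0)
    (hPb : a = b → suffixSum N z b = suffixSum N p b) (h : ColInv N p q z b a st) :
    SegInv N p q z a (colFlush a b st) := by
  have hrow : ∀ i < a, ∑ c ∈ Finset.range N, st.m i c = 0 := fun i hi => by
    rw [h.row_lt i hi]
    split_ifs with hb
    · rw [hPb (by omega), sub_self]
    · rfl
  rcases Nat.eq_zero_or_pos a with rfl | ha
  · -- at the first position the remaining pieces add up to `1 - 1`
    have hR : ∀ l, st.R l = 0 := fun l => by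
      have hs := h.R_sum
      rw [h0, sub_self, Finset.sum_eq_zero_iff_of_nonneg fun l _ => h.R_nonneg l] at hs
      by_cases hl : l < b
      · exact hs l (by simpa using hl)
      · exact h.R_out l (by omega)
    have he : MinEntropyJoint.colFlush 0 b st = st := by simp [MinEntropyJoint.colFlush]
    rw [he]
    constructor
    · exact hR
    · exact h.C_eq
    · exact h.m_nonneg
    · intro l c hl; omega
    · exact h.m_out
    · intro i hi hiN; simpa [hR] using h.hook_sum i hi hiN
    · intro i hi hiN; simpa [hR] using h.hook_card i hi hiN
    · intro i hi hiN; simpa [hR] using h.row_ge i hi hiN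
    · intro i hi; omega
    · exact h.col_ge
    · intro i hi; omega
  · have hm : (MinEntropyJoint.colFlush a b st).m = addCol st.m (a - 1) st.R := by
      funext l c
      simp only [MinEntropyJoint.colFlush, ha.ne', if_false, addCol]
      by_cases hc : c = a - 1
      · by_cases hl : a ≤ l ∧ l < b
        · by_cases hR : st.R l = 0
          · simp [hR]
          · simp [hc, hl, hR, h.m_lt l (a - 1) hl.2 (by omega)]
        · have hR : st.R l = 0 := h.R_out l (by omega)
          simp [hR]
      · simp [hc]
    have hRlt : ∀ l < a - 1, st.R l = 0 := fun l hl => h.R_out l (by omega)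
    constructor
    · intro l
      simp only [MinEntropyJoint.colFlush, ha.ne', if_false]
      split_ifs with hl
      · rfl
      · exact h.R_out l (by omega)
    · intro l
      simpa [MinEntropyJoint.colFlush, ha.ne'] using h.C_eq l
    · intro l c
      rw [hm, addCol]
      have := h.m_nonneg l c
      have := h.R_nonneg l
      split_ifs <;> linarith
    · intro l c hl hc
      rw [hm, addCol, h.m_lt l c (by omega) hc, h.R_out l (Or.inl hl)]
      simp
    · intro l c hlc
      rw [hm, addCol, h.m_out l c hlc, zero_add]
      split_ifs with hc
      · exact h.R_out l (by omega)
      · rfl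
    · intro i hi hiN
      rw [hm, sum_hook_addCol (by omega) hiN _ _ hRlt]
      exact h.hook_sum i hi hiN
    · intro i hi hiN
      rw [hm]
      exact (hookCard_addCol_le _ _ hRlt).trans (h.hook_card i hi hiN)
    · intro i hi hiN
      rw [hm, sum_row_addCol (by omega)]
      exact h.row_ge i hi hiN
    · intro i hi
      rw [hm, sum_row_addCol (by omega), hrow i hi, h.R_out i (Or.inl hi), hP]
      simp
    · intro i hi hiN
      rw [hm, sum_col_addCol, if_neg (by omega), add_zero]
      exact h.col_ge i hi hiN
    · intro i hi
      have hs : ∑ l ∈ Finset.range N, st.R l = suffixSum N z a - suffixSum N q a := by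
        rw [← h.R_sum]
        symm
        apply Finset.sum_subset
        · intro l hl
          rw [Finset.mem_Ico] at hl
          rw [Finset.mem_range]; omega
        · intro l _ hl
          rw [Finset.mem_Ico] at hl
          exact h.R_out l (by omega)
      rw [hm, sum_col_addCol, h.col_lt i hi, hs, zero_add]
      exact if_congr (by omega) rfl rfl

/-! ### Exchanging rows and columns -/

/-- The state with rows and columns exchanged. -/
def State.swap (st : State) : State := ⟨fun l c => st.m c l, st.C, st.R⟩

theorem sum_hook_swap (N i : ℕ) (g : ℕ → ℕ → ℝ) :
    ∑ x ∈ hook N i, g x.2 x.1 = ∑ x ∈ hook N i, g x.1 x.2 := by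
  apply Finset.sum_nbij' Prod.swap Prod.swap <;>
    simp +contextual [mem_hook, max_comm]

theorem hookCard_swap (N i : ℕ) (m : ℕ → ℕ → ℝ) :
    hookCard N (fun l c => m c l) i = hookCard N m i := by
  unfold hookCard
  apply Finset.card_nbij' Prod.swap Prod.swap <;> intro x hx <;>
    simp_all [mem_hook, max_comm]

theorem SegInv.swap {N : ℕ} {p q z : ℕ → ℝ} {b : ℕ} {st : State} (h : SegInv N p q z b st) :
    SegInv N q p z b st.swap where
  R_eq := h.C_eq
  C_eq := h.R_eq
  m_nonneg l c := h.m_nonneg c l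
  m_lt l c hl hc := h.m_lt c l hc hl
  m_out l c hlc := h.m_out c l hlc.symm
  hook_sum i hi hiN := (sum_hook_swap N i st.m).trans (h.hook_sum i hi hiN)
  hook_card i hi hiN := (hookCard_swap N i st.m).trans_le (h.hook_card i hi hiN)
  row_ge := h.col_ge
  row_lt := h.col_lt
  col_ge := h.row_ge
  col_lt := h.row_lt

theorem foldl_rowStep (z p : ℕ → ℝ) (b : ℕ) (js : List ℕ) (st : State) :
    js.foldl (rowStep z p b) st = (js.foldl (colStep z p b) st.swap).swap := by
  induction js generalizing st with
  | nil => rfl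
  | cons j js ih =>
    rw [List.foldl_cons, ih]
    rfl

theorem rowFlush_eq (a b : ℕ) (st : State) : rowFlush a b st = (colFlush a b st.swap).swap := by
  unfold rowFlush colFlush
  split_ifs <;> rfl

/-! ### The main loop -/

theorem IsOrderedProb.suffixSum_eq {N : ℕ} {x : ℕ → ℝ} (hx : IsOrderedProb N x) (i : ℕ) :
    suffixSum N x i = 1 - ∑ l ∈ Finset.range i, x l := by
  unfold suffixSum
  rcases le_total i N with h | h
  · rw [← hx.2.2.2, ← Finset.sum_range_add_sum_Ico _ h]
    ring
  · rw [Finset.Ico_eq_empty_of_le h, Finset.sum_empty, ← hx.2.2.2,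
      ← Finset.sum_range_add_sum_Ico _ h, Finset.sum_eq_zero (s := Finset.Ico N i), add_zero, sub_self]
    intro l hl
    exact hx.2.2.1 l (Finset.mem_Ico.mp hl).1

theorem prefixMin_pair (p q : ℕ → ℝ) (i : ℕ) :
    prefixMin ![p, q] i = min (∑ l ∈ Finset.range i, p l) (∑ l ∈ Finset.range i, q l) := by
  apply le_antisymm
  · exact le_min (Finset.inf'_le (f := fun a => ∑ l ∈ Finset.range i, ![p, q] a l)
      (Finset.mem_univ 0)) (Finset.inf'_le (f := fun a => ∑ l ∈ Finset.range i, ![p, q] a l)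
      (Finset.mem_univ 1))
  · unfold prefixMin
    rw [Finset.le_inf'_iff]
    intro a _
    fin_cases a
    · exact min_le_left _ _
    · exact min_le_right _ _

theorem meet_pair_comm (p q : ℕ → ℝ) : meet ![p, q] = meet ![q, p] := by
  funext i
  simp only [meet, prefixMin_pair, min_comm]

theorem IsOrderedProb.meet_pair {N : ℕ} {p q : ℕ → ℝ} (hp : IsOrderedProb N p)
    (hq : IsOrderedProb N q) : IsOrderedProb N (meet ![p, q]) :=
  (meet_isGreatest _ (by intro a; fin_cases a; exacts [hp, hq])).1

theorem suffixSum_meet_pair {N : ℕ} {p q : ℕ → ℝ} (hp : IsOrderedProb N p)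
    (hq : IsOrderedProb N q) (i : ℕ) :
    suffixSum N (meet ![p, q]) i = max (suffixSum N p i) (suffixSum N q i) := by
  rw [(hp.meet_pair hq).suffixSum_eq, sum_meet, prefixMin_pair, hp.suffixSum_eq, hq.suffixSum_eq]
  rcases le_total (∑ l ∈ Finset.range i, p l) (∑ l ∈ Finset.range i, q l) with h | h
  · rw [min_eq_left h, max_eq_left (by linarith)]
  · rw [min_eq_right h, max_eq_right (by linarith)]

/-- On an odd segment `z` has the suffix sums of `p`. At its upper end `b` it has those of `q`, so
the segment starts without pieces to be placed in columns. -/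
theorem SegInv.odd_segment {N : ℕ} {p q : ℕ → ℝ} {a b : ℕ} {st : State}
    (hp : IsOrderedProb N p) (hq : IsOrderedProb N q) (hab : a ≤ b) (hbN : b ≤ N)
    (hb : suffixSum N p b ≤ suffixSum N q b)
    (hseg : ∀ i, a ≤ i → i < b → suffixSum N q i ≤ suffixSum N p i)
    (ha : suffixSum N q a ≤ suffixSum N p a) (h : SegInv N p q (meet ![p, q]) b st) :
    SegInv N p q (meet ![p, q]) a (colFlush a b
      ((List.range' a (b - a)).reverse.foldl (colStep (meet ![p, q]) q b) st)) := by
  have hz := hp.meet_pair hq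
  have hZ := suffixSum_meet_pair hp hq
  refine ColInv.colFlush hab hbN (by rw [hZ, max_eq_left ha]) ?_ ?_ ?_
  · rw [hz.suffixSum_eq, hq.suffixSum_eq]; simp
  · rintro rfl
    rw [hZ, max_eq_left ha]
  · refine ColInv.foldl_colStep hz.1 hz.2.1 hq.2.1 hbN (fun i => ?_)
      (h.colInv hz.2.1 (by rw [hZ, max_eq_right hb])) (b - a) a (by omega) fun i hi hib => ?_
    · rw [hZ]; exact le_max_right _ _
    · rw [hZ, max_eq_left (hseg i hi hib)]

theorem SegInv.even_segment {N : ℕ} {p q : ℕ → ℝ} {a b : ℕ} {st : State}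
    (hp : IsOrderedProb N p) (hq : IsOrderedProb N q) (hab : a ≤ b) (hbN : b ≤ N)
    (hb : suffixSum N q b ≤ suffixSum N p b)
    (hseg : ∀ i, a ≤ i → i < b → suffixSum N p i ≤ suffixSum N q i)
    (ha : suffixSum N p a ≤ suffixSum N q a) (h : SegInv N p q (meet ![p, q]) b st) :
    SegInv N p q (meet ![p, q]) a (rowFlush a b
      ((List.range' a (b - a)).reverse.foldl (rowStep (meet ![p, q]) p b) st)) := by
  rw [meet_pair_comm] at h ⊢
  rw [foldl_rowStep, rowFlush_eq]
  exact (SegInv.odd_segment hq hp hab hbN hb hseg ha h.swap).swap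

/-- A segment is maximal: either it reaches the first position or its condition fails just below
it. -/
theorem segStart_eq_zero_or_not (P : ℕ → Prop) [DecidablePred P] (b : ℕ) :
    segStart P b = 0 ∨ ¬ P (segStart P b - 1) := by
  induction b with
  | zero => exact Or.inl rfl
  | succ b ih =>
    unfold segStart
    split_ifs with h
    · exact ih
    · exact Or.inr h

theorem segStart_lt (P : ℕ → Prop) [DecidablePred P] {b : ℕ} (hb : 0 < b) (h : P (b - 1)) :
    segStart P b < b := by
  obtain ⟨b, rfl⟩ : ∃ c, b = c + 1 := ⟨b - 1, by omega⟩
  unfold segStart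
  rw [if_pos (by simpa using h)]
  exact Nat.lt_succ_of_le (segStart_isLeast P b).1.1

/-- The relation between the suffix sums of `p` and `q` that holds on segment `s`. -/
def SegRel (N : ℕ) (p q : ℕ → ℝ) (s i : ℕ) : Prop :=
  if Odd s then suffixSum N q i ≤ suffixSum N p i else suffixSum N p i ≤ suffixSum N q i

theorem inversionPoint_succ_le (N : ℕ) (p q : ℕ → ℝ) (s : ℕ) :
    inversionPoint N p q (s + 1) ≤ inversionPoint N p q s := by
  rw [inversionPoint]
  split_ifs <;> exact (segStart_isLeast _ _).1.1

theorem inversionPoint_le (N : ℕ) (p q : ℕ → ℝ) (s : ℕ) : inversionPoint N p q s ≤ N := by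
  induction s with
  | zero => exact le_rfl
  | succ s ih => exact (inversionPoint_succ_le N p q s).trans ih

theorem segRel_of_mem (N : ℕ) (p q : ℕ → ℝ) (s i : ℕ) (h1 : inversionPoint N p q (s + 1) ≤ i)
    (h2 : i < inversionPoint N p q s) : SegRel N p q (s + 1) i := by
  rw [inversionPoint] at h1
  unfold SegRel
  split_ifs with h <;> simp only [h, if_true, if_false] at h1 <;>
    exact (segStart_isLeast _ _).1.2 i h1 h2

theorem segRel_flip {N : ℕ} {p q : ℕ → ℝ} {s i : ℕ} (h : ¬ SegRel N p q s i) :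
    SegRel N p q (s + 1) i := by
  unfold SegRel at *
  by_cases hs : Odd s
  · have hs' : ¬ Odd (s + 1) := by simpa [Nat.odd_add_one] using hs
    rw [if_pos hs, not_le] at h
    rw [if_neg hs']
    exact h.le
  · have hs' : Odd (s + 1) := by simpa [Nat.odd_add_one] using hs
    rw [if_neg hs, not_le] at h
    rw [if_pos hs']
    exact h.le

/-- A segment cannot be extended downwards, so the following one is not empty. This can fail for
the segment with `s = 1`, which is empty if the two vectors are in the wrong order. -/
theorem inversionPoint_lt {N : ℕ} {p q : ℕ → ℝ} {s : ℕ} (h : 0 < inversionPoint N p q (s + 1)) :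
    inversionPoint N p q (s + 1 + 1) < inversionPoint N p q (s + 1) := by
  have h1 : ¬ SegRel N p q (s + 1) (inversionPoint N p q (s + 1) - 1) := by
    rw [inversionPoint] at h ⊢
    unfold SegRel
    split_ifs with hs <;> simp only [hs, if_true, if_false] at h
    · exact (segStart_eq_zero_or_not _ _).resolve_left h.ne'
    · exact (segStart_eq_zero_or_not _ _).resolve_left h.ne'
  have h2 := segRel_flip h1
  rw [inversionPoint]
  unfold SegRel at h2
  split_ifs with hs
  · rw [if_pos hs] at h2
    exact segStart_lt _ h h2
  · rw [if_neg hs] at h2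
    exact segStart_lt _ h h2

theorem inversionPoint_numSegments (N : ℕ) (p q : ℕ → ℝ) :
    inversionPoint N p q (numSegments N p q) = 0 := by
  have hbound : ∀ s, inversionPoint N p q (s + 1) ≤ N - s := fun s => by
    induction s with
    | zero => exact inversionPoint_le N p q 1
    | succ s ih =>
      rcases Nat.eq_zero_or_pos (inversionPoint N p q (s + 1)) with h | h
      · have := inversionPoint_succ_le N p q (s + 1)
        omega
      · have := inversionPoint_lt h
        omega
  exact Nat.sInf_mem (s := {s | inversionPoint N p q s = 0})
    ⟨N + 1, by simpa using hbound N⟩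

theorem segRel_inversionPoint {N : ℕ} {p q : ℕ → ℝ} (hp : IsOrderedProb N p)
    (hq : IsOrderedProb N q) (s : ℕ) : SegRel N p q s (inversionPoint N p q s) := by
  have hN : ∀ s, SegRel N p q s N := fun s => by simp [SegRel, suffixSum_self]
  have h0 : ∀ s, SegRel N p q s 0 := fun s => by
    simp [SegRel, hp.suffixSum_eq, hq.suffixSum_eq]
  cases s with
  | zero => exact hN 0
  | succ s =>
    rcases (inversionPoint_succ_le N p q s).lt_or_eq with h | h
    · exact segRel_of_mem N p q s _ le_rfl h
    · cases s with
      | zero => rw [h]; exact hN _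
      | succ s =>
        rcases Nat.eq_zero_or_pos (inversionPoint N p q (s + 1)) with h' | h'
        · rw [h, h']; exact h0 _
        · exact absurd h (inversionPoint_lt h').ne

theorem segInv_foldl {N : ℕ} {p q : ℕ → ℝ} (hp : IsOrderedProb N p) (hq : IsOrderedProb N q)
    (s : ℕ) : SegInv N p q (meet ![p, q]) (inversionPoint N p q s)
      ((List.range' 1 s).foldl (segmentStep N p q) State.init) := by
  induction s with
  | zero => exact SegInv.init N p q _
  | succ s ih =>
    rw [List.range'_1_concat, List.foldl_append, List.foldl_cons, List.foldl_nil, add_comm 1 s]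
    have hle := inversionPoint_succ_le N p q s
    have hN := inversionPoint_le N p q s
    have hb := segRel_inversionPoint hp hq s
    have ha := segRel_inversionPoint hp hq (s + 1)
    have hseg := segRel_of_mem N p q s
    unfold segmentStep
    simp only [Nat.add_sub_cancel]
    unfold SegRel at hb ha hseg
    by_cases hs : Odd (s + 1)
    · have hs' : ¬ Odd s := by simpa [Nat.odd_add_one] using hs
      simp only [hs, hs', if_true, if_false] at hb ha hseg ⊢
      exact ih.odd_segment hp hq hle hN hb hseg ha
    · have hs' : Odd s := by simpa [Nat.odd_add_one] using hs
      simp only [hs, hs', if_true, if_false] at hb ha hseg ⊢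
      exact ih.even_segment hp hq hle hN hb hseg ha

/-- The matrix `m` is a joint distribution of `p` and `q`, and it arises from `z` by splitting
each component into at most two: those of `z i` form the hook with corner `(i, i)`. -/
structure IsSplitCoupling (N : ℕ) (p q z : ℕ → ℝ) (m : ℕ → ℕ → ℝ) : Prop where
  nonneg : ∀ l c, 0 ≤ m l c
  eq_zero : ∀ l c, N ≤ l ∨ N ≤ c → m l c = 0
  row : ∀ i < N, ∑ c ∈ Finset.range N, m i c = p i
  col : ∀ i < N, ∑ l ∈ Finset.range N, m l i = q i
  hook_sum : ∀ i < N, ∑ x ∈ hook N i, m x.1 x.2 = z i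
  hook_card : ∀ i < N, hookCard N m i ≤ 2

theorem isSplitCoupling_mainLoop {N : ℕ} {p q : ℕ → ℝ} (hp : IsOrderedProb N p)
    (hq : IsOrderedProb N q) :
    IsSplitCoupling N p q (meet ![p, q]) (mainLoop N p q) := by
  have h := segInv_foldl hp hq (numSegments N p q)
  rw [inversionPoint_numSegments] at h
  exact ⟨h.m_nonneg, h.m_out, fun i => h.row_ge i (Nat.zero_le i),
    fun i => h.col_ge i (Nat.zero_le i), fun i => h.hook_sum i (Nat.zero_le i),
    fun i => h.hook_card i (Nat.zero_le i)⟩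

/-- The algorithm is correct for `p` and `q` in either order; exchanging them is not needed
for this. -/
theorem isSplitCoupling_minEntropyJoint {N : ℕ} {p q : ℕ → ℝ} (hp : IsOrderedProb N p)
    (hq : IsOrderedProb N q) :
    IsSplitCoupling N p q (meet ![p, q]) (minEntropyJoint N p q) := by
  unfold minEntropyJoint
  split_ifs
  · have h := isSplitCoupling_mainLoop hq hp
    rw [meet_pair_comm]
    exact ⟨fun l c => h.nonneg c l, fun l c hlc => h.eq_zero c l hlc.symm, h.col, h.row,
      fun i hi => (sum_hook_swap N i _).trans (h.hook_sum i hi),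
      fun i hi => (hookCard_swap N i _).trans_le (h.hook_card i hi)⟩
  · exact isSplitCoupling_mainLoop hp hq

/-! ### Halving and majorization -/

/-- The vector in which each component of `w` is replaced by two halves. -/
noncomputable def halve (w : ℕ → ℝ) : ℕ → ℝ := fun i => w (i / 2) / 2

theorem sum_range_two_mul_div (g : ℕ → ℝ) (N : ℕ) :
    ∑ i ∈ Finset.range (2 * N), g (i / 2) = ∑ i ∈ Finset.range N, 2 * g i := by
  induction N with
  | zero => simp
  | succ N ih =>
    rw [mul_add, mul_one, Finset.sum_range_succ, Finset.sum_range_succ, Finset.sum_range_succ, ih,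
      show 2 * N / 2 = N by omega, show (2 * N + 1) / 2 = N by omega]
    ring

theorem sum_halve (w : ℕ → ℝ) (N : ℕ) :
    ∑ i ∈ Finset.range (2 * N), halve w i = ∑ i ∈ Finset.range N, w i := by
  unfold halve
  rw [sum_range_two_mul_div (fun i => w i / 2)]
  exact Finset.sum_congr rfl fun i _ => by ring

theorem Majorized.halve {x y : ℕ → ℝ} (h : Majorized x y) : Majorized (halve x) (halve y) := by
  intro i
  rcases Nat.even_or_odd' i with ⟨k, rfl | rfl⟩
  · rw [sum_halve, sum_halve]
    exact h k
  · -- an odd prefix sum of the halves is the mean of two consecutive prefix sums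
    have h1 := h k
    have h2 := h (k + 1)
    rw [Finset.sum_range_succ, Finset.sum_range_succ] at h2
    rw [Finset.sum_range_succ, Finset.sum_range_succ, sum_halve, sum_halve]
    simp only [MinEntropyJoint.halve, show 2 * k / 2 = k by omega]
    linarith

theorem Majorized.trans {x y z : ℕ → ℝ} (h : Majorized x y) (h' : Majorized y z) :
    Majorized x z := fun i => (h i).trans (h' i)

theorem Majorized.meet_pair {w p q : ℕ → ℝ} (hp : Majorized w p) (hq : Majorized w q) :
    Majorized w (meet ![p, q]) := fun i => by
  rw [sum_meet, prefixMin_pair]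
  exact le_min (hp i) (hq i)

theorem IsOrderedProb.halve {N : ℕ} {w : ℕ → ℝ} (h : IsOrderedProb N w) :
    IsOrderedProb (2 * N) (halve w) := by
  refine ⟨fun i j hij => ?_, fun i => ?_, fun i hi => ?_, ?_⟩
  · have := h.1 (Nat.div_le_div_right (c := 2) hij)
    simp only [MinEntropyJoint.halve]
    linarith
  · have := h.2.1 (i / 2)
    simp only [MinEntropyJoint.halve]
    linarith
  · simp only [MinEntropyJoint.halve]
    rw [h.2.2.1 (i / 2) (by omega), zero_div]
  · rw [sum_halve, h.2.2.2]

theorem IsOrderedProb.mono {N N' : ℕ} {w : ℕ → ℝ} (h : IsOrderedProb N w) (hN : N ≤ N') :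
    IsOrderedProb N' w := by
  refine ⟨h.1, h.2.1, fun i hi => h.2.2.1 i (hN.trans hi), ?_⟩
  rw [← h.2.2.2]
  symm
  apply Finset.sum_subset (Finset.range_mono hN)
  intro l _ hl
  exact h.2.2.1 l (by simpa using hl)

/-- The prefix sums of a non-increasing sequence, computed with the threshold `c = x k`. -/
theorem threshold_le_sum_range {x : ℕ → ℝ} (hx : Antitone x) (N k : ℕ) :
    k * x k + ∑ i ∈ Finset.range N, max (x i - x k) 0 ≤ ∑ i ∈ Finset.range k, x i := by
  have h : ∑ i ∈ Finset.range N, max (x i - x k) 0 ≤ ∑ i ∈ Finset.range k, (x i - x k) := by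
    have h1 : ∀ i ∈ Finset.range N,
        max (x i - x k) 0 = if i < k then x i - x k else 0 := fun i _ => by
      split_ifs with hi
      · exact max_eq_left (sub_nonneg.mpr (hx hi.le))
      · exact max_eq_right (sub_nonpos.mpr (hx (not_lt.mp hi)))
    rw [Finset.sum_congr rfl h1, ← Finset.sum_filter]
    apply Finset.sum_le_sum_of_subset_of_nonneg
    · intro i hi
      exact Finset.mem_range.mpr (Finset.mem_filter.mp hi).2
    · intro i hi _
      exact sub_nonneg.mpr (hx (Finset.mem_range.mp hi).le)
  rw [Finset.sum_sub_distrib, Finset.sum_const, Finset.card_range, nsmul_eq_mul] at h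
  linarith

theorem sum_range_le_threshold {y : ℕ → ℝ} {N : ℕ} (hy : ∀ i, N ≤ i → y i = 0) {c : ℝ}
    (hc : 0 ≤ c) (k : ℕ) :
    ∑ i ∈ Finset.range k, y i ≤ k * c + ∑ i ∈ Finset.range N, max (y i - c) 0 := by
  have h : ∑ i ∈ Finset.range k, (y i - c) ≤ ∑ i ∈ Finset.range N, max (y i - c) 0 := by
    calc ∑ i ∈ Finset.range k, (y i - c)
        ≤ ∑ i ∈ Finset.range k, max (y i - c) 0 :=
          Finset.sum_le_sum fun i _ => le_max_left _ _
      _ = ∑ i ∈ (Finset.range k).filter (· < N), max (y i - c) 0 := by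
          symm
          apply Finset.sum_subset (Finset.filter_subset _ _)
          intro i hi hi'
          have : N ≤ i := by
            by_contra hlt
            exact hi' (Finset.mem_filter.mpr ⟨hi, not_le.mp hlt⟩)
          rw [hy i this, zero_sub, max_eq_right (by linarith)]
      _ ≤ ∑ i ∈ Finset.range N, max (y i - c) 0 := by
          apply Finset.sum_le_sum_of_subset_of_nonneg
          · intro i hi
            exact Finset.mem_range.mpr (Finset.mem_filter.mp hi).2
          · intro i _ _
            exact le_max_right _ _
  rw [Finset.sum_sub_distrib, Finset.sum_const, Finset.card_range, nsmul_eq_mul] at h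
  linarith

theorem IsSplitCoupling.eq_zero_of_row {N : ℕ} {p q z : ℕ → ℝ} {m : ℕ → ℕ → ℝ}
    (h : IsSplitCoupling N p q z m) {l c : ℕ} (hl : p l = 0) : m l c = 0 := by
  by_cases hlc : l < N ∧ c < N
  · have hs := h.row l hlc.1
    rw [hl, Finset.sum_eq_zero_iff_of_nonneg fun c _ => h.nonneg l c] at hs
    exact hs c (Finset.mem_range.mpr hlc.2)
  · exact h.eq_zero l c (by omega)

theorem IsSplitCoupling.eq_zero_of_col {N : ℕ} {p q z : ℕ → ℝ} {m : ℕ → ℕ → ℝ}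
    (h : IsSplitCoupling N p q z m) {l c : ℕ} (hc : q c = 0) : m l c = 0 := by
  by_cases hlc : l < N ∧ c < N
  · have hs := h.col c hlc.2
    rw [hc, Finset.sum_eq_zero_iff_of_nonneg fun l _ => h.nonneg l c] at hs
    exact hs l (Finset.mem_range.mpr hlc.1)
  · exact h.eq_zero l c (by omega)

/-- Two non-zero parts of `z i` lose at most `2 c` when they are reduced by `c`. -/
theorem IsSplitCoupling.sum_halve_le {N : ℕ} {p q z : ℕ → ℝ} {m : ℕ → ℕ → ℝ}
    (h : IsSplitCoupling N p q z m) (hz : ∀ i, N ≤ i → z i = 0) {c : ℝ} (hc : 0 ≤ c) (k : ℕ) :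
    ∑ i ∈ Finset.range k, halve z i ≤
      k * c + ∑ s ∈ Finset.range N, ∑ t ∈ Finset.range N, max (m s t - c) 0 := by
  have hk := sum_range_le_threshold (y := halve z) (N := 2 * N)
    (fun i hi => by rw [halve, hz _ (by omega), zero_div]) hc k
  refine hk.trans (add_le_add le_rfl ?_)
  unfold halve
  rw [sum_range_two_mul_div (fun i => max (z i / 2 - c) 0), ← Finset.sum_product',
    ← Finset.sum_fiberwise_of_maps_to (s := Finset.range N ×ˢ Finset.range N)
      (t := Finset.range N) (g := fun x => max x.1 x.2)]
  · apply Finset.sum_le_sum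
    intro i hi
    change _ ≤ ∑ x ∈ hook N i, max (m x.1 x.2 - c) 0
    rw [mul_max_of_nonneg _ _ zero_le_two]
    apply max_le
    · have hs := h.hook_sum i (Finset.mem_range.mp hi)
      have hcard : ((hookCard N m i : ℕ) : ℝ) ≤ 2 := by
        exact_mod_cast h.hook_card i (Finset.mem_range.mp hi)
      rw [← Finset.sum_filter_ne_zero] at hs
      calc 2 * (z i / 2 - c) = z i - 2 * c := by ring
        _ ≤ z i - hookCard N m i * c := by nlinarith
        _ = ∑ x ∈ (hook N i).filter (fun x => m x.1 x.2 ≠ 0), (m x.1 x.2 - c) := by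
          rw [Finset.sum_sub_distrib, hs, Finset.sum_const, nsmul_eq_mul, hookCard]
        _ ≤ ∑ x ∈ (hook N i).filter (fun x => m x.1 x.2 ≠ 0), max (m x.1 x.2 - c) 0 :=
          Finset.sum_le_sum fun _ _ => le_max_left _ _
        _ ≤ _ := Finset.sum_le_sum_of_subset_of_nonneg (Finset.filter_subset _ _)
          fun _ _ _ => le_max_right _ _
    · rw [mul_zero]
      exact Finset.sum_nonneg fun _ _ => le_max_right _ _
  · rintro ⟨l, c⟩ hx
    simp only [Finset.mem_product, Finset.mem_range] at hx ⊢
    exact max_lt hx.1 hx.2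

/-! ### The nodes of the tree -/

variable {n : ℕ}

theorem Node.val_of_le (a : Node n) {i : ℕ} (h : a.length ≤ i) : Node.val a i = 0 := by
  rw [Node.val, List.getD_eq_default _ _ h]

theorem Node.val_of_lt (a : Node n) {i : ℕ} (h : i < a.length) : Node.val a i = a[i].1 := by
  rw [Node.val, List.getD_eq_getElem _ _ h]

theorem Node.idx_of_lt (a : Node n) {i : ℕ} (h : i < a.length) : Node.idx a i = a[i].2 := by
  rw [Node.idx, List.getD_eq_getElem _ _ h]

theorem Node.val_nonneg {a : Node n} (h : ∀ e ∈ a, 0 ≤ e.1) (i : ℕ) : 0 ≤ Node.val a i := by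
  rcases lt_or_ge i a.length with hi | hi
  · rw [Node.val_of_lt a hi]; exact h _ (List.getElem_mem hi)
  · rw [Node.val_of_le a hi]

theorem Node.antitone_val {a : Node n} (hs : a.Pairwise fun u v => v.1 ≤ u.1)
    (h : ∀ e ∈ a, 0 ≤ e.1) : Antitone (Node.val a) := by
  intro i j hij
  rcases lt_or_ge j a.length with hj | hj
  · rcases hij.eq_or_lt with rfl | hij
    · exact le_rfl
    · rw [Node.val_of_lt a hj, Node.val_of_lt a (hij.trans hj)]
      exact List.pairwise_iff_getElem.mp hs i j (hij.trans hj) hj hij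
  · rw [Node.val_of_le a hj]; exact Node.val_nonneg h i

theorem Node.sum_map (a : Node n) {N : ℕ} (hN : a.length ≤ N) (g : ℝ → List (Fin n) → ℝ)
    (hg : ∀ v, g 0 v = 0) :
    (a.map fun e => g e.1 e.2).sum =
      ∑ i ∈ Finset.range N, g (Node.val a i) (Node.idx a i) := by
  induction a generalizing N with
  | nil => simp [Node.val, hg]
  | cons e a ih =>
    obtain ⟨N, rfl⟩ : ∃ N', N = N' + 1 := ⟨N - 1, by simp at hN; omega⟩
    rw [Finset.sum_range_succ', List.map_cons, List.sum_cons, ih (by simpa using hN), add_comm]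
    simp [Node.val, Node.idx]

theorem sum_map_filter_range (f : ℕ → ℝ) (P : ℕ → Prop) [DecidablePred P] (N : ℕ) :
    (((List.range N).filter fun t => P t).map f).sum =
      ∑ t ∈ Finset.range N, if P t then f t else 0 := by
  induction N with
  | zero => simp
  | succ N ih =>
    rw [List.range_succ, List.filter_append, List.map_append, List.sum_append, ih,
      Finset.sum_range_succ]
    by_cases h : P N <;> simp [h]

theorem sum_map_sortNode (a : Node n) (g : ℝ × List (Fin n) → ℝ) :
    ((sortNode a).map g).sum = (a.map g).sum :=
  ((List.perm_insertionSort _ a).map g).sum_eq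

/-- Sums over a joined node are double sums over the matrix that the algorithm for two
distributions returns. -/
theorem sum_map_join (a b : Node n) {z : ℕ → ℝ}
    (hM : IsSplitCoupling (max a.length b.length) (Node.val a) (Node.val b) z
      (minEntropyJoint (max a.length b.length) (Node.val a) (Node.val b)))
    (g : ℝ → List (Fin n) → ℝ) (hg : ∀ v, g 0 v = 0) :
    ((join a b).map fun e => g e.1 e.2).sum =
      ∑ s ∈ Finset.range (max a.length b.length), ∑ t ∈ Finset.range (max a.length b.length),
        g (minEntropyJoint (max a.length b.length) (Node.val a) (Node.val b) s t)
          (Node.idx a s ++ Node.idx b t) := by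
  unfold join
  set N := max a.length b.length with hN
  set M := minEntropyJoint N (Node.val a) (Node.val b) with hMdef
  have hinner : ∀ s, ∑ t ∈ Finset.range N, g (M s t) (Node.idx a s ++ Node.idx b t) =
      ∑ t ∈ Finset.range b.length, g (M s t) (Node.idx a s ++ Node.idx b t) := fun s => by
    symm
    apply Finset.sum_subset (Finset.range_mono (le_max_right _ _))
    intro t _ ht
    rw [hM.eq_zero_of_col (Node.val_of_le b (by simpa using ht)), hg]
  have houter : ∑ s ∈ Finset.range N, ∑ t ∈ Finset.range N,
        g (M s t) (Node.idx a s ++ Node.idx b t) =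
      ∑ s ∈ Finset.range a.length, ∑ t ∈ Finset.range N,
        g (M s t) (Node.idx a s ++ Node.idx b t) := by
    symm
    apply Finset.sum_subset (Finset.range_mono (le_max_left _ _))
    intro s _ hs
    apply Finset.sum_eq_zero
    intro t _
    rw [hM.eq_zero_of_row (Node.val_of_le a (by simpa using hs)), hg]
  rw [houter, sum_map_sortNode, List.map_flatMap, List.flatMap_def, List.sum_flatten,
    List.map_map, ← List.sum_toFinset _ List.nodup_range, List.toFinset_range]
  apply Finset.sum_congr rfl
  intro s _
  rw [hinner, Function.comp_apply, List.map_map]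
  have := sum_map_filter_range (fun t => g (M s t) (Node.idx a s ++ Node.idx b t))
    (fun t => M s t ≠ 0) b.length
  refine Eq.trans ?_ (this.trans ?_)
  · rfl
  · apply Finset.sum_congr rfl
    intro t _
    split_ifs with h
    · rfl
    · rw [not_not.mp h, hg]

/-- The node `a` at level `ℓ` carries a joint distribution of block `s` of the distributions
`p 0, p 1, …`, its index vectors being distinct, and its values majorize the vector obtained from
`w` by halving each component `ℓ` times. -/
structure NodeInv (p : ℕ → Fin n → ℝ) (w : ℕ → ℝ) (ℓ s : ℕ) (a : Node n) : Prop where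
  sorted : a.Pairwise fun u v => v.1 ≤ u.1
  nonneg : ∀ e ∈ a, 0 ≤ e.1
  sum_eq : (a.map fun e => e.1).sum = 1
  length_eq : ∀ e ∈ a, e.2.length = 2 ^ ℓ
  nodup : (a.map Prod.snd).Nodup
  marg : ∀ i < 2 ^ ℓ, ∀ t,
    (a.map fun e => if e.2[i]? = some t then e.1 else 0).sum = p (s * 2 ^ ℓ + i) t
  maj : Majorized (halve^[ℓ] w) (Node.val a)

theorem NodeInv.isOrderedProb {p : ℕ → Fin n → ℝ} {w : ℕ → ℝ} {ℓ s : ℕ} {a : Node n}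
    (h : NodeInv p w ℓ s a) : IsOrderedProb a.length (Node.val a) := by
  refine ⟨Node.antitone_val h.sorted h.nonneg, Node.val_nonneg h.nonneg,
    fun i hi => Node.val_of_le a hi, ?_⟩
  rw [← h.sum_eq]
  exact (Node.sum_map a le_rfl (fun v _ => v) fun _ => rfl).symm

theorem NodeInv.idx_inj {p : ℕ → Fin n → ℝ} {w : ℕ → ℝ} {ℓ s : ℕ} {a : Node n}
    (h : NodeInv p w ℓ s a) {i j : ℕ} (hi : i < a.length) (hj : j < a.length)
    (hij : Node.idx a i = Node.idx a j) : i = j := by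
  rw [Node.idx_of_lt a hi, Node.idx_of_lt a hj] at hij
  exact (h.nodup.getElem_inj_iff (hi := by simpa) (hj := by simpa)).mp (by simpa using hij)

theorem NodeInv.length_idx {p : ℕ → Fin n → ℝ} {w : ℕ → ℝ} {ℓ s : ℕ} {a : Node n}
    (h : NodeInv p w ℓ s a) {i : ℕ} (hi : i < a.length) : (Node.idx a i).length = 2 ^ ℓ := by
  rw [Node.idx_of_lt a hi]
  exact h.length_eq _ (List.getElem_mem hi)

theorem pairwise_sortNode (a : Node n) : (sortNode a).Pairwise fun u v => v.1 ≤ u.1 := by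
  have : Std.Total (fun u v : ℝ × List (Fin n) => v.1 ≤ u.1) := ⟨fun u v => le_total v.1 u.1⟩
  have : IsTrans (ℝ × List (Fin n)) (fun u v => v.1 ≤ u.1) := ⟨fun _ _ _ h h' => h'.trans h⟩
  exact List.pairwise_insertionSort _ a

/-- At a leaf, sorting the pairs by value sorts the values. -/
theorem val_leaf (x : Fin n → ℝ) : Node.val (leaf x) = sortDesc x := by
  have h : (leaf x).map Prod.fst =
      (List.ofFn x).insertionSort (fun a b => b ≤ a) := by
    unfold leaf sortNode
    rw [List.map_insertionSort (r := fun u v : ℝ × List (Fin n) => v.1 ≤ u.1)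
      (s := fun a b : ℝ => b ≤ a), List.map_ofFn]
    · rfl
    · intros; rfl
  funext i
  rw [sortDesc, ← h, Node.val]
  exact (List.getD_map (f := Prod.fst) (d := ((0 : ℝ), ([] : List (Fin n)))) ..).symm

theorem nodeInv_leaf (p : ℕ → Fin n → ℝ) (w : ℕ → ℝ) (s : ℕ) (hp : p s ∈ stdSimplex ℝ (Fin n))
    (hw : Majorized w (sortDesc (p s))) : NodeInv p w 0 s (leaf (p s)) where
  sorted := pairwise_sortNode _
  nonneg e he := by
    have := (List.perm_insertionSort _ _).mem_iff.mp he
    simp only [List.mem_ofFn] at this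
    obtain ⟨j, rfl⟩ := this
    exact hp.1 j
  sum_eq := by
    unfold leaf
    rw [sum_map_sortNode, List.map_ofFn, List.sum_ofFn]
    exact hp.2
  length_eq e he := by
    have := (List.perm_insertionSort _ _).mem_iff.mp he
    simp only [List.mem_ofFn] at this
    obtain ⟨j, rfl⟩ := this
    rfl
  nodup := by
    refine ((List.perm_insertionSort _ _).map Prod.snd).nodup_iff.mpr ?_
    rw [List.map_ofFn, List.nodup_ofFn]
    intro i j hij
    simpa using hij
  marg i hi t := by
    obtain rfl : i = 0 := by simpa using hi
    unfold leaf
    rw [sum_map_sortNode, List.map_ofFn, List.sum_ofFn]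
    simp
  maj := by rw [val_leaf]; exact hw

theorem NodeInv.join {p : ℕ → Fin n → ℝ} {w : ℕ → ℝ} {ℓ s : ℕ} {a b : Node n}
    (ha : NodeInv p w ℓ (2 * s) a) (hb : NodeInv p w ℓ (2 * s + 1) b) :
    NodeInv p w (ℓ + 1) s (join a b) := by
  have hpa := ha.isOrderedProb.mono (le_max_left a.length b.length)
  have hpb := hb.isOrderedProb.mono (le_max_right a.length b.length)
  have hM := isSplitCoupling_minEntropyJoint hpa hpb
  have hsum := sum_map_join a b hM
  have hmem : ∀ e ∈ MinEntropyJoint.join a b, ∃ s < a.length, ∃ t < b.length,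
      e = (minEntropyJoint (max a.length b.length) (Node.val a) (Node.val b) s t,
        Node.idx a s ++ Node.idx b t) := fun e he => by
    have := (List.perm_insertionSort _ _).mem_iff.mp he
    simp only [List.mem_flatMap, List.mem_range, List.mem_map, List.mem_filter] at this
    obtain ⟨s, hs, t, ht, rfl⟩ := this
    exact ⟨s, hs, t, ht.1, rfl⟩
  have hnonneg : ∀ e ∈ MinEntropyJoint.join a b, 0 ≤ e.1 := fun e he => by
    obtain ⟨s, _, t, _, rfl⟩ := hmem e he
    exact hM.nonneg s t
  have hnodup : ((MinEntropyJoint.join a b).map Prod.snd).Nodup := by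
    refine ((List.perm_insertionSort _ _).map Prod.snd).nodup_iff.mpr ?_
    rw [List.map_flatMap, List.nodup_flatMap]
    constructor
    · intro s hs
      rw [List.map_map]
      refine List.Nodup.map_on ?_ (List.nodup_range.filter _)
      intro t ht t' ht' htt'
      simp only [List.mem_filter, List.mem_range] at ht ht'
      exact hb.idx_inj ht.1 ht'.1 (List.append_cancel_left htt')
    · refine List.Pairwise.imp_of_mem ?_ List.nodup_range
      intro s s' hs hs' hne
      simp only [List.mem_range] at hs hs'
      intro v hv hv'
      simp only [List.mem_map, List.mem_filter, List.mem_range] at hv hv'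
      obtain ⟨_, ⟨t, _, rfl⟩, rfl⟩ := hv
      obtain ⟨_, ⟨t', _, rfl⟩, he⟩ := hv'
      have := (List.append_inj he (by rw [ha.length_idx hs, ha.length_idx hs'])).1
      exact hne (ha.idx_inj hs' hs this).symm
  have hsorted := pairwise_sortNode ((List.range a.length).flatMap fun s =>
    ((List.range b.length).filter fun t => minEntropyJoint (max a.length b.length)
      (Node.val a) (Node.val b) s t ≠ 0).map fun t =>
      (minEntropyJoint (max a.length b.length) (Node.val a) (Node.val b) s t,
        Node.idx a s ++ Node.idx b t))
  change (MinEntropyJoint.join a b).Pairwise _ at hsorted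
  set N := max a.length b.length with hN
  set M := minEntropyJoint N (Node.val a) (Node.val b) with hMdef
  have hsum1 : ((MinEntropyJoint.join a b).map fun e => e.1).sum = 1 := by
    rw [hsum (fun v _ => v) fun _ => rfl, ← hpa.2.2.2]
    exact Finset.sum_congr rfl fun s hs => hM.row s (Finset.mem_range.mp hs)
  refine ⟨hsorted, hnonneg, hsum1, ?_, hnodup, ?_, ?_⟩
  · intro e he
    obtain ⟨s, hs, t, ht, rfl⟩ := hmem e he
    rw [List.length_append, ha.length_idx hs, hb.length_idx ht, pow_succ]
    ring
  · intro i hi t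
    rw [hsum (fun v x => if x[i]? = some t then v else 0) (by simp)]
    rcases lt_or_ge i (2 ^ ℓ) with hiℓ | hiℓ
    · have h := ha.marg i hiℓ t
      rw [show 2 * s * 2 ^ ℓ + i = s * 2 ^ (ℓ + 1) + i by ring] at h
      rw [← h, Node.sum_map a (le_max_left a.length b.length)
        (fun v x => if x[i]? = some t then v else 0) (by simp)]
      apply Finset.sum_congr rfl
      intro l hl
      rw [Finset.mem_range] at hl
      rcases lt_or_ge l a.length with hla | hla
      · have : ∀ c, (Node.idx a l ++ Node.idx b c)[i]? = (Node.idx a l)[i]? := fun c =>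
          List.getElem?_append_left (by rw [ha.length_idx hla]; exact hiℓ)
        simp_rw [this]
        split_ifs
        · exact hM.row l hl
        · simp
      · rw [Node.val_of_le a hla]
        simp only [ite_self]
        apply Finset.sum_eq_zero
        intro c _
        rw [hM.eq_zero_of_row (Node.val_of_le a hla), ite_self]
    · have h := hb.marg (i - 2 ^ ℓ) (by rw [pow_succ] at hi; omega) t
      have hidx : (2 * s + 1) * 2 ^ ℓ + (i - 2 ^ ℓ) = s * 2 ^ (ℓ + 1) + i := by
        obtain ⟨d, rfl⟩ := Nat.exists_eq_add_of_le hiℓ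
        rw [Nat.add_sub_cancel_left]
        ring
      rw [hidx] at h
      rw [← h, Node.sum_map b (le_max_right a.length b.length)
        (fun v x => if x[i - 2 ^ ℓ]? = some t then v else 0) (by simp), Finset.sum_comm]
      apply Finset.sum_congr rfl
      intro c hc
      rw [Finset.mem_range] at hc
      rw [← hM.col c hc]
      have hterm : ∀ l ∈ Finset.range N,
          (if (Node.idx a l ++ Node.idx b c)[i]? = some t then M l c else 0) =
            if (Node.idx b c)[i - 2 ^ ℓ]? = some t then M l c else 0 := fun l _ => by
        rcases lt_or_ge l a.length with hla | hla
        · rw [List.getElem?_append_right (by rw [ha.length_idx hla]; exact hiℓ),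
            ha.length_idx hla]
        · rw [hM.eq_zero_of_row (Node.val_of_le a hla), ite_self, ite_self]
      rw [Finset.sum_congr rfl hterm]
      split_ifs
      · rfl
      · simp
  · have hz := hpa.meet_pair hpb
    rw [Function.iterate_succ_apply']
    refine (ha.maj.meet_pair hb.maj).halve.trans fun k => ?_
    set x := Node.val (MinEntropyJoint.join a b) with hx
    have hx0 : ∀ i, 0 ≤ x i := Node.val_nonneg hnonneg
    have hanti : Antitone x := Node.antitone_val hsorted hnonneg
    have h1 := hM.sum_halve_le hz.2.2.1 (hx0 k) k
    have h2 := threshold_le_sum_range hanti (MinEntropyJoint.join a b).length k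
    have h3 := hsum (fun v _ => max (v - x k) 0) fun _ => by simpa using hx0 k
    rw [Node.sum_map _ le_rfl (fun v _ => max (v - x k) 0) fun _ => by simpa using hx0 k] at h3
    rw [← hx] at h3
    linarith

theorem nodeInv_node (p : ℕ → Fin n → ℝ) (w : ℕ → ℝ) (hp : ∀ s, p s ∈ stdSimplex ℝ (Fin n))
    (hw : ∀ s, Majorized w (sortDesc (p s))) (ℓ s : ℕ) : NodeInv p w ℓ s (node p ℓ s) := by
  induction ℓ generalizing s with
  | zero => exact nodeInv_leaf p w s (hp s) (hw s)
  | succ ℓ ih => exact (ih _).join (ih _)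

/-! ### Entropy -/

/-- The contribution of a single component to the entropy. -/
noncomputable def entropyTerm (t : ℝ) : ℝ := t * Real.logb 2 (1 / t)

theorem entropyTerm_zero : entropyTerm 0 = 0 := zero_mul _

theorem two_mul_entropyTerm_half {t : ℝ} (ht : 0 ≤ t) :
    2 * entropyTerm (t / 2) = entropyTerm t + t := by
  rcases ht.eq_or_lt with rfl | ht
  · simp [entropyTerm]
  · have h : Real.logb 2 (1 / (t / 2)) = Real.logb 2 (1 / t) + 1 := by
      rw [show 1 / (t / 2) = 1 / t * 2 by field_simp,
        Real.logb_mul (by positivity) two_ne_zero, Real.logb_self_eq_one one_lt_two]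
    rw [entropyTerm, h, entropyTerm]
    ring

/-- The tangent line inequality behind Gibbs' inequality. -/
theorem entropyTerm_le {x y : ℝ} (hx : 0 ≤ x) (hy : 0 < y) :
    entropyTerm x ≤ x * Real.logb 2 (1 / y) + (y - x) / Real.log 2 := by
  have hl : 0 < Real.log 2 := Real.log_pos one_lt_two
  rcases hx.eq_or_lt with rfl | hx
  · rw [entropyTerm_zero, zero_mul, zero_add, sub_zero]
    positivity
  · have h := mul_le_mul_of_nonneg_left (Real.log_le_sub_one_of_pos (div_pos hy hx)) hx.le
    rw [Real.log_div hy.ne' hx.ne', mul_sub, mul_sub, mul_div_cancel₀ _ hx.ne', mul_one] at h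
    unfold entropyTerm Real.logb
    rw [one_div, one_div, Real.log_inv, Real.log_inv, ← mul_div_assoc, ← mul_div_assoc, ← add_div]
    exact div_le_div_of_nonneg_right (by linarith) hl.le

/-- Summation by parts: a sequence with non-positive prefix sums, weighted by non-decreasing
weights. -/
theorem sum_range_mul_ge (d L : ℕ → ℝ) (k : ℕ) (hL : ∀ i < k, L i ≤ L (i + 1))
    (hd : ∀ i ≤ k, ∑ l ∈ Finset.range i, d l ≤ 0) :
    (∑ l ∈ Finset.range (k + 1), d l) * L k ≤ ∑ l ∈ Finset.range (k + 1), d l * L l := by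
  induction k with
  | zero => simp
  | succ k ih =>
    have h1 := ih (fun i hi => hL i (by omega)) fun i hi => hd i (by omega)
    rw [Finset.sum_range_succ _ (k + 1), Finset.sum_range_succ _ (k + 1), add_mul]
    have h2 := mul_le_mul_of_nonpos_left (hL k (Nat.lt_succ_self k)) (hd (k + 1) le_rfl)
    linarith

/-- Entropy is Schur-concave. -/
theorem sum_entropyTerm_le_of_majorized {x y : ℕ → ℝ} (hx : ∀ i, 0 ≤ x i) (hy : Antitone y)
    (hy0 : ∀ i, 0 ≤ y i) (h : Majorized y x) (N : ℕ)
    (hN : ∑ i ∈ Finset.range N, x i = ∑ i ∈ Finset.range N, y i) :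
    ∑ i ∈ Finset.range N, entropyTerm (x i) ≤ ∑ i ∈ Finset.range N, entropyTerm (y i) := by
  induction N with
  | zero => simp
  | succ N ih =>
    rcases (hy0 N).eq_or_lt with h0 | hpos
    · -- the last component of `y` vanishes, hence so does that of `x`
      have hN' := hN
      rw [Finset.sum_range_succ, Finset.sum_range_succ, ← h0, add_zero] at hN'
      have hxN : x N = 0 := by
        have := h N
        have := hx N
        linarith
      rw [hxN, add_zero] at hN'
      rw [Finset.sum_range_succ, Finset.sum_range_succ, hxN, ← h0, entropyTerm_zero, add_zero,
        add_zero]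
      exact ih hN'
    · have hypos : ∀ i ≤ N, 0 < y i := fun i hi => hpos.trans_le (hy hi)
      have h1 : ∑ i ∈ Finset.range (N + 1), entropyTerm (x i) ≤ ∑ i ∈ Finset.range (N + 1),
          (x i * Real.logb 2 (1 / y i) + (y i - x i) / Real.log 2) :=
        Finset.sum_le_sum fun i hi => entropyTerm_le (hx i)
          (hypos i (Nat.lt_succ_iff.mp (Finset.mem_range.mp hi)))
      rw [Finset.sum_add_distrib, ← Finset.sum_div, Finset.sum_sub_distrib, hN, sub_self,
        zero_div, add_zero] at h1
      have h2 := sum_range_mul_ge (fun i => y i - x i) (fun i => Real.logb 2 (1 / y i)) N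
        (fun i hi => Real.logb_le_logb_of_le one_lt_two
          (one_div_pos.mpr (hypos i hi.le))
          (one_div_le_one_div_of_le (hypos (i + 1) hi) (hy (Nat.le_succ i))))
        (fun i _ => by rw [Finset.sum_sub_distrib]; linarith [h i])
      rw [Finset.sum_sub_distrib, hN, sub_self, zero_mul] at h2
      simp only [sub_mul, Finset.sum_sub_distrib] at h2
      unfold entropyTerm at h1 ⊢
      linarith

theorem sum_entropyTerm_halve {w : ℕ → ℝ} {N : ℕ} (hw : IsOrderedProb N w) :
    ∑ i ∈ Finset.range (2 * N), entropyTerm (halve w i) =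
      ∑ i ∈ Finset.range N, entropyTerm (w i) + 1 := by
  unfold halve
  rw [sum_range_two_mul_div (fun i => entropyTerm (w i / 2)), ← hw.2.2.2,
    ← Finset.sum_add_distrib]
  exact Finset.sum_congr rfl fun i _ => two_mul_entropyTerm_half (hw.2.1 i)

theorem iterate_halve {w : ℕ → ℝ} {N : ℕ} (hw : IsOrderedProb N w) (ℓ : ℕ) :
    IsOrderedProb (2 ^ ℓ * N) (halve^[ℓ] w) ∧
      ∑ i ∈ Finset.range (2 ^ ℓ * N), entropyTerm ((halve^[ℓ] w) i) =
        ∑ i ∈ Finset.range N, entropyTerm (w i) + ℓ := by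
  induction ℓ with
  | zero => simpa using hw
  | succ ℓ ih =>
    rw [Function.iterate_succ_apply', pow_succ', mul_assoc]
    refine ⟨ih.1.halve, ?_⟩
    rw [sum_entropyTerm_halve ih.1, ih.2]
    push_cast
    ring

theorem NodeInv.sum_entropyTerm_le {n : ℕ} {p : ℕ → Fin n → ℝ} {w : ℕ → ℝ} {N ℓ s : ℕ}
    {a : Node n} (h : NodeInv p w ℓ s a) (hw : IsOrderedProb N w) :
    (a.map fun e => entropyTerm e.1).sum ≤ ∑ i ∈ Finset.range N, entropyTerm (w i) + ℓ := by
  obtain ⟨h1, h2⟩ := iterate_halve hw ℓ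
  have hx := h.isOrderedProb.mono (le_max_right (2 ^ ℓ * N) a.length)
  have hy := h1.mono (le_max_left (2 ^ ℓ * N) a.length)
  rw [Node.sum_map a (le_max_right (2 ^ ℓ * N) a.length) (fun v _ => entropyTerm v)
    fun _ => entropyTerm_zero, ← h2]
  refine (sum_entropyTerm_le_of_majorized hx.2.1 h1.1 h1.2.1 h.maj _
    (hx.2.2.2.trans hy.2.2.2.symm)).trans_eq ?_
  symm
  apply Finset.sum_subset (Finset.range_mono (le_max_left _ _))
  intro i _ hi
  rw [h1.2.2.1 i (by simpa using hi), entropyTerm_zero]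

/-! ### Writing the final list into an array -/

/-- Writing values at distinct positions: each position outside the list keeps its value. -/
theorem apply_foldl_write {n K : ℕ} (φ : ℝ → ℝ) (L : Node n) (hL : (L.map Prod.snd).Nodup)
    (M : (Fin K → Fin n) → ℝ) (x : Fin K → Fin n) :
    φ (L.foldl (fun M e x => if List.ofFn x = e.2 then e.1 else M x) M x) =
      (L.map fun e => if List.ofFn x = e.2 then φ e.1 else 0).sum +
        if List.ofFn x ∈ L.map Prod.snd then 0 else φ (M x) := by
  induction L generalizing M with
  | nil => simp
  | cons e L ih =>
    rw [List.map_cons, List.nodup_cons] at hL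
    rw [List.foldl_cons, ih hL.2, List.map_cons, List.sum_cons, List.map_cons]
    by_cases h : List.ofFn x = e.2
    · rw [← h] at hL
      rw [if_neg hL.1, if_pos h, if_pos h, if_pos (List.mem_cons.mpr (Or.inl h))]
      ring
    · rw [if_neg h, if_neg h, zero_add]
      congr 1
      exact if_congr (by rw [List.mem_cons, or_iff_right h]) rfl rfl

theorem sum_list_ofFn_eq {n K : ℕ} (L : Node n) (hL : ∀ e ∈ L, e.2.length = K)
    (g : ℝ → List (Fin n) → ℝ) :
    ∑ x : Fin K → Fin n, (L.map fun e => if List.ofFn x = e.2 then g e.1 e.2 else 0).sum =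
      (L.map fun e => g e.1 e.2).sum := by
  induction L with
  | nil => simp
  | cons e L ih =>
    simp only [List.map_cons, List.sum_cons, Finset.sum_add_distrib]
    rw [ih fun e' he' => hL e' (by simp [he'])]
    congr 1
    obtain rfl := hL e (by simp)
    rw [Finset.sum_eq_single e.2.get]
    · simp
    · intro x _ hx
      rw [if_neg]
      intro h
      exact hx (List.ofFn_injective (h.trans (List.ofFn_get e.2).symm))
    · simp

/-- Since the index vectors at the root are distinct, sums over the output array are sums over the
list at the root. -/
theorem sum_kMinEntropyJoint {n κ : ℕ} {p : Fin (2 ^ κ) → Fin n → ℝ} {w : ℕ → ℝ}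
    (h : NodeInv (fun s => p (Fin.ofNat (2 ^ κ) s)) w κ 0
      (node (fun s => p (Fin.ofNat (2 ^ κ) s)) κ 0))
    (φ : ℝ → ℝ) (hφ : φ 0 = 0) (P : List (Fin n) → Prop) [DecidablePred P] :
    ∑ x, (if P (List.ofFn x) then φ (kMinEntropyJoint p x) else 0) =
      ((node (fun s => p (Fin.ofNat (2 ^ κ) s)) κ 0).map fun e =>
        if P e.2 then φ e.1 else 0).sum := by
  rw [← sum_list_ofFn_eq _ h.length_eq fun v x => if P x then φ v else 0]
  apply Finset.sum_congr rfl
  intro x _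
  rw [kMinEntropyJoint, apply_foldl_write φ _ h.nodup, hφ, ite_self, add_zero]
  split_ifs with hP
  · congr 1
    apply List.map_congr_left
    intro e _
    split_ifs with h1 h2
    · rfl
    · exact absurd (h1 ▸ hP) h2
    · rfl
  · symm
    apply List.sum_eq_zero
    intro r hr
    obtain ⟨e, _, rfl⟩ := List.mem_map.mp hr
    split_ifs with h1 h2
    · exact absurd (h1 ▸ h2) hP
    · rfl
    · rfl

theorem isJoint_kMinEntropyJoint {n κ : ℕ} {p : Fin (2 ^ κ) → Fin n → ℝ} {w : ℕ → ℝ}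
    (h : NodeInv (fun s => p (Fin.ofNat (2 ^ κ) s)) w κ 0
      (node (fun s => p (Fin.ofNat (2 ^ κ) s)) κ 0)) :
    IsJoint p (kMinEntropyJoint p) := by
  constructor
  · intro x
    have hx := apply_foldl_write id _ h.nodup (fun _ => 0) x
    simp only [id, ite_self, add_zero] at hx
    rw [kMinEntropyJoint, hx]
    apply List.sum_nonneg
    intro r hr
    obtain ⟨e, he, rfl⟩ := List.mem_map.mp hr
    split_ifs
    exacts [h.nonneg e he, le_rfl]
  · intro i t
    have h1 := sum_kMinEntropyJoint h id rfl fun v => v[(i : ℕ)]? = some t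
    have h2 := h.marg i i.isLt t
    simp only [id] at h1
    rw [h2, zero_mul, zero_add] at h1
    have hi : Fin.ofNat (2 ^ κ) (i : ℕ) = i := by
      ext; simp
    rw [hi] at h1
    rw [← h1, Finset.sum_filter]
    apply Finset.sum_congr rfl
    intro x _
    simp

theorem entropy_kMinEntropyJoint_le {n κ : ℕ} {p : Fin (2 ^ κ) → Fin n → ℝ} {w : ℕ → ℝ}
    (h : NodeInv (fun s => p (Fin.ofNat (2 ^ κ) s)) w κ 0
      (node (fun s => p (Fin.ofNat (2 ^ κ) s)) κ 0)) (hw : IsOrderedProb n w) :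
    entropy (kMinEntropyJoint p) ≤ entropy (fun j : Fin n => w j) + κ := by
  have h1 := sum_kMinEntropyJoint h entropyTerm entropyTerm_zero fun _ => True
  simp only [if_true] at h1
  have h2 := h.sum_entropyTerm_le hw
  rw [← h1, Finset.sum_range] at h2
  exact h2

/-! ### Marginals -/

/-- Subadditivity of `t ↦ t * logb 2 (1 / t)`. -/
theorem entropyTerm_sum_le {ι : Type*} (s : Finset ι) (a : ι → ℝ) (ha : ∀ i, 0 ≤ a i) :
    entropyTerm (∑ i ∈ s, a i) ≤ ∑ i ∈ s, entropyTerm (a i) := by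
  rw [entropyTerm, Finset.sum_mul]
  apply Finset.sum_le_sum
  intro i hi
  rcases (ha i).eq_or_lt with h | h
  · rw [← h, entropyTerm_zero, zero_mul]
  · have hle : a i ≤ ∑ i ∈ s, a i := Finset.single_le_sum (fun i _ => ha i) hi
    exact mul_le_mul_of_nonneg_left (Real.logb_le_logb_of_le one_lt_two
      (one_div_pos.mpr (h.trans_le hle)) (one_div_le_one_div_of_le h hle)) h.le

theorem entropy_marginal_le {n k K : ℕ} (e : Fin k → Fin K) (M : (Fin K → Fin n) → ℝ)
    (hM : ∀ x, 0 ≤ M x) : entropy (marginal e M) ≤ entropy M := by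
  change ∑ x, entropyTerm (∑ y with y ∘ e = x, M y) ≤ ∑ y, entropyTerm (M y)
  rw [← Finset.sum_fiberwise Finset.univ (fun y => y ∘ e) fun y => entropyTerm (M y)]
  exact Finset.sum_le_sum fun x _ => entropyTerm_sum_le _ _ hM

theorem IsJoint.marginal {n k K : ℕ} {p : Fin K → Fin n → ℝ} {M : (Fin K → Fin n) → ℝ}
    (h : IsJoint p M) (e : Fin k → Fin K) : IsJoint (p ∘ e) (marginal e M) := by
  refine ⟨fun x => Finset.sum_nonneg fun y _ => h.1 y, fun i t => ?_⟩
  unfold MinEntropyJoint.marginal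
  rw [Finset.sum_fiberwise_eq_sum_filter, Function.comp_apply, ← h.2 (e i) t]
  simp

theorem isOrderedProb_sortDesc {n : ℕ} {p : Fin n → ℝ} (hp : p ∈ stdSimplex ℝ (Fin n)) :
    IsOrderedProb n (sortDesc p) := by
  have h := (nodeInv_leaf (fun _ => p) (sortDesc p) 0 hp fun _ => le_rfl).isOrderedProb
  rwa [val_leaf, leaf, sortNode, List.length_insertionSort, List.length_ofFn] at h

end MinEntropyJoint

theorem corollary3 {n k κ : ℕ} [NeZero k] (hκ : (κ : ℤ) = ⌈Real.logb 2 (k : ℝ)⌉)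
    (p : Fin k → Fin n → ℝ) (hp : ∀ i, p i ∈ stdSimplex ℝ (Fin n))
    (f : Fin (2 ^ κ) → Fin k) (e : Fin k → Fin (2 ^ κ)) (hfe : ∀ i, f (e i) = i) :
    (IsJoint (p ∘ f) (kMinEntropyJoint (p ∘ f)) ∧
      entropy (kMinEntropyJoint (p ∘ f)) ≤
        entropy (fun j : Fin n => meet (fun i => sortDesc (p i)) j)
          + (⌈Real.logb 2 (k : ℝ)⌉ : ℝ)) ∧
    (IsJoint p (marginal e (kMinEntropyJoint (p ∘ f))) ∧
      entropy (marginal e (kMinEntropyJoint (p ∘ f))) ≤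
        entropy (fun j : Fin n => meet (fun i => sortDesc (p i)) j)
          + (⌈Real.logb 2 (k : ℝ)⌉ : ℝ)) := by
  obtain ⟨hw, hmaj, -⟩ := meet_isGreatest (fun i => sortDesc (p i))
    fun i => isOrderedProb_sortDesc (hp i)
  have hroot := nodeInv_node (fun s => (p ∘ f) (Fin.ofNat (2 ^ κ) s))
    (meet fun i => sortDesc (p i)) (fun s => hp _) (fun s => hmaj _) κ 0
  have hJ := isJoint_kMinEntropyJoint hroot
  have hH := entropy_kMinEntropyJoint_le hroot hw
  have hκ' : (κ : ℝ) = (⌈Real.logb 2 (k : ℝ)⌉ : ℝ) := by exact_mod_cast hκ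
  rw [hκ'] at hH
  have hpe : (p ∘ f) ∘ e = p := by
    funext i
    simp only [Function.comp_apply, hfe]
  refine ⟨⟨hJ, hH⟩, ?_, (entropy_marginal_le e _ hJ.1).trans hH⟩
  have := hJ.marginal e
  rwa [hpe] at this
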